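/- Let $T=[-\pi,\pi)$ and $\|g\|_p=\left(\int_T|g|^p\right)^{1/p}$. For $g\in L^1(T)$ (complex-valued) let $\hat g(k)=\frac1{2\pi}\int_T g(x)e^{-ikx}\,dx$, \[ S_ng(y)=\sum_{k=-n}^{n}\hat g(k)e^{iky},\qquad \sigma_ng=\frac1{n+1}\sum_{k=0}^{n}S_kg,\qquad V_ng=\frac1n\sum_{l=n}^{2n-1}S_lg . \] The dyadic intervals are the intervals $[-\pi+2\pi k2^{-n},\,-\pi+2\pi(k+1)2^{-n})$ with $n\ge 0$, $0\le k<2^n$. For a dyadic interval $I$ and an odd natural number $\gamma$, let $\gamma I=\bigcup_{|i|\le(\gamma-1)/2}(I+i|I|)$, where translations are taken modulo $2\pi$ in $T$. Given $f\in L^1(T)$ and $\lambda>\|f\|_1/(2\pi)$, let $\mathcal F$ be the set of dyadic intervals $I$ such that $|I|^{-1}\int_I|f|>\lambda$ and $|J|^{-1}\int_J|f|\le\lambda$ for every dyadic $J\supsetneq I$, and for $\varepsilon>0$ let $\gamma F_\varepsilon=\bigcup_{I\in\mathcal F,\,|I|>\varepsilon}\gamma I$. The complement of a set $E$ in $T$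 is denoted by $\overline E$. \textbf{Lemma (orthogonality).} For every odd integer $\beta>7$ there is a constant $C_\beta$, depending only on $\beta$, such that the following holds. Let $f\in L^1(T)$, $\lambda>\|f\|_1/(2\pi)$, and let $(n_j)_{j\ge1}$ be a sequence of positive integers with $n_{j+1}\ge q\,n_j$ for all $j\ge 1$, where $q>2.5$. Put $\beta_j=20(j+1)\log^2(j+1)/n_j$, $m_j=\lfloor n_j/10\rfloor$ and \[ g_j=\left(S_{n_j}f-V_{n_j}f\right)\,\sigma_{m_j}1_{\overline{\beta F_{\beta_j}}}\qquad(j\ge1). \] Then $\int_T g_i\,\overline{g_j}=0$ for all $i\ne j$, and for every $N\in\mathbb N$ \[ \left\|\sum_{j=1}^{N}g_j\right\|_2^2=\sum_{j=1}^{N}\|g_j\|_2^2\le C_\beta\,N\log^5(N+1)\,\|f\|_1\,\lambda . \] -/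

import Mathlib

open MeasureTheory

noncomputable section

namespace TrigFourier

/-- The interval `T = [-π, π)`. -/
def T : Set ℝ := Set.Ico (-Real.pi) Real.pi

/-- The `k`-th Fourier coefficient over `T`. -/
def coeff (f : ℝ → ℂ) (k : ℤ) : ℂ :=
  fourierCoeffOn (neg_lt_self Real.pi_pos) f k

/-- The explicit formula for the Fourier coefficient. -/
theorem coeff_eq_integral (f : ℝ → ℂ) (k : ℤ) :
    coeff f k = 1 / (2 * Real.pi) *
      ∫ x in T, f x * Complex.exp (-(Complex.I * k * x)) := by
  have hpi : (-Real.pi) ≤ Real.pi := (neg_lt_self Real.pi_pos).le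
  have hc : Real.pi - -Real.pi = 2 * Real.pi := by ring
  rw [coeff, fourierCoeffOn_eq_integral, T, integral_Ico_eq_integral_Ioc,
    intervalIntegral.integral_of_le hpi, hc, Complex.real_smul]
  congr 1
  · push_cast; ring
  · refine integral_congr_ae (Filter.Eventually.of_forall fun x => ?_)
    simp only [smul_eq_mul]
    rw [mul_comm, fourier_coe_apply]
    congr 2
    have : (Real.pi : ℂ) ≠ 0 := by exact_mod_cast Real.pi_ne_zero
    push_cast
    field_simp

/-- The partial sum `S_n f`. -/
def partialSum (n : ℕ) (f : ℝ → ℂ) (y : ℝ) : ℂ :=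
  ∑ k ∈ Finset.Icc (-(n : ℤ)) (n : ℤ), coeff f k * Complex.exp (Complex.I * k * y)

/-- The Fejér mean `σ_n f`. -/
def fejerMean (n : ℕ) (f : ℝ → ℂ) (y : ℝ) : ℂ :=
  1 / ((n : ℂ) + 1) * ∑ k ∈ Finset.range (n + 1), partialSum k f y

/-- The de la Vallée-Poussin mean `V_n f`, the average of `S_n f, …, S_{2n-1} f`. -/
def vpMean (n : ℕ) (f : ℝ → ℂ) (y : ℝ) : ℂ :=
  1 / (n : ℂ) * ∑ l ∈ Finset.Ico n (2 * n), partialSum l f y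

/-- The `k`-th interval (`0 ≤ k < 2 ^ n`) of the partition of `T` into `2 ^ n` intervals
of length `2π / 2 ^ n`. -/
def dyadicInterval (n : ℕ) (k : ℤ) : Set ℝ :=
  Set.Ico (-Real.pi + k * (2 * Real.pi / 2 ^ n)) (-Real.pi + (k + 1) * (2 * Real.pi / 2 ^ n))

/-- The pairs `(n, k)` that index the dyadic subintervals of `T`. -/
def dyadicIndex : Set (ℕ × ℤ) := {p | 0 ≤ p.2 ∧ p.2 < 2 ^ p.1}

/-- The (indices of the) maximal dyadic intervals on which the mean of `|f|` exceeds `lam`. -/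
def czFamily (f : ℝ → ℂ) (lam : ℝ) : Set (ℕ × ℤ) :=
  {p | p ∈ dyadicIndex ∧ lam < (⨍ x in dyadicInterval p.1 p.2, ‖f x‖) ∧
    ∀ r ∈ dyadicIndex, dyadicInterval p.1 p.2 ⊂ dyadicInterval r.1 r.2 →
      (⨍ x in dyadicInterval r.1 r.2, ‖f x‖) ≤ lam}

/-- The dilate `γ I` (`γ` odd) of the dyadic interval `I` with index `p`: the union of the
neighbours `I + i |I|`, `|i| ≤ (γ - 1) / 2`, taken modulo `2π`. -/
def dilate (γ : ℕ) (p : ℕ × ℤ) : Set ℝ :=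
  ⋃ i ∈ Set.Icc (-(((γ - 1) / 2 : ℕ) : ℤ)) (((γ - 1) / 2 : ℕ) : ℤ),
    dyadicInterval p.1 ((p.2 + i) % 2 ^ p.1)

/-- The set `γ F_ε`: the union of `γ I` over those selected intervals `I` with `|I| > ε`. -/
def dilatedSet (f : ℝ → ℂ) (lam : ℝ) (γ : ℕ) (ε : ℝ) : Set ℝ :=
  ⋃ p ∈ {p | p ∈ czFamily f lam ∧ ε < 2 * Real.pi / 2 ^ p.1}, dilate γ p

/-- The threshold `20 (j + 1) log² (j + 1) / n_j`. -/
def threshold (n : ℕ → ℕ) (j : ℕ) : ℝ :=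
  20 * ((j : ℝ) + 1) * Real.log ((j : ℝ) + 1) ^ 2 / (n j : ℝ)

/-- The function `(S_{n_j} f - V_{n_j} f) · σ_{m_j} 1_{T \ β F_{β_j}}`, where
`m_j = ⌊n_j / 10⌋` and `β_j` is the threshold above. -/
def term (f : ℝ → ℂ) (lam : ℝ) (β : ℕ) (n : ℕ → ℕ) (j : ℕ) (y : ℝ) : ℂ :=
  (partialSum (n j) f y - vpMean (n j) f y) *
    fejerMean (n j / 10)
      ((T \ dilatedSet f lam β (threshold n j)).indicator fun _ => (1 : ℂ)) y

/-- The squared norm of `L²(T)`. -/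
def l2NormSq (g : ℝ → ℂ) : ℝ := ∫ y in T, ‖g y‖ ^ 2

end TrigFourier

end

noncomputable section

namespace TrigFourier

/-! ### The chordal distance and Poisson-type bumps -/

/-! Orthogonality is a matter of spectra. The frequencies of `S_n f - V_n f` satisfy `n < |k| ≤ 2n`,
and the Fejér factor of degree `⌊n/10⌋` moves them by at most `n/10`. So `g_j` lives on `0.9 n_j <
|k| ≤ 2.1 n_j`, and these bands are disjoint because `2.1/0.9 = 7/3 < 5/2`.

For the norm of one `g_j`, conjugation reduces matters to the positive frequencies of `V_n f - S_n
f`. Let `Q` be the union of the selected intervals longer than the threshold, and split `f` into `f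
1_Q` and `f 1_{T \ Q}`.

The part on `Q` is a Calderón–Zygmund argument (`l2NormSq_posPart_bigSet_le`). Multiplication by
`e^{-inx}` turns the operator into one whose kernel has regularity bounds uniform in `n`
(`norm_ker_sub_ker_le`). The modulated function is replaced by its means on the selected intervals
plus mean-zero pieces. The means are `O(λ)`, and Bessel's inequality handles them. A mean-zero piece
on an interval `I` decays quadratically away from `I` by kernel regularity. Near `I` it is only `O(n
λ |I|)`, but there the weight is `O(1/(n|I|))`, since the set whose indicator is averaged avoids
`βI` (`norm_badTerm_mul_le`). So each piece is dominated by `λ` times a bump adapted to `I`, and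
sums of such bumps over disjoint intervals have squared `L²` norm `O(∑ |I|)`
(`integral_sum_phi_sq_le`). Since `λ ∑ |I| ≤ ‖f‖₁`, this part is `O(λ ‖f‖₁)`.

On `T \ Q` the weight is just bounded by one. The coefficients with `n < k ≤ 2n` are controlled by a
quadratic form with a Fejér kernel at scale `1/n`, hence by an energy of `|f|` against a bump of
that width (`l2NormSq_posPart_indicator_le`). The selected intervals are removed from this energy
level by level. At each level the means of what remains are at most `2λ`, so removing intervals of
length `ℓ` costs `O(λ ℓ)` times the mass of `f` on them (`lintegral_energy_step`). This gives a
bound `O(λ (‖f‖₁ + ∑ n ℓ · mass_ℓ))` over lengths `ℓ` between about `1/n` and the threshold.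

In the sum over `j`, only those `j` with `n_j ℓ ≤ L := 20 (N+1) log²(N+1)` contribute at a fixed
length `ℓ`, and by lacunarity these `n_j ℓ` add up to at most `2L`. The level masses sum to at most
`‖f‖₁`. The total is `O(λ ‖f‖₁ (N + (N+1) log²(N+1)))`, so the fifth power of the logarithm is not
needed for large `N`. The constant does not depend on `β`. -/

/-- The point `e^{ix}` of the unit circle. -/
def cis (x : ℝ) : ℂ := Complex.exp (Complex.I * x)

theorem norm_cis (x : ℝ) : ‖cis x‖ = 1 := by
  rw [cis, mul_comm, Complex.norm_exp_ofReal_mul_I]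

theorem continuous_cis : Continuous cis := by unfold cis; fun_prop

theorem cis_add (x y : ℝ) : cis (x + y) = cis x * cis y := by
  rw [cis, cis, cis, ← Complex.exp_add]; push_cast; ring_nf

theorem cis_sub_mul (x y : ℝ) : cis (x - y) * cis y = cis x := by
  rw [← cis_add, sub_add_cancel]

theorem cis_two_pi : cis (2 * Real.pi) = 1 := by
  rw [cis, mul_comm]; push_cast; exact Complex.exp_two_pi_mul_I

/-- The chordal distance of `e^{ix}` and `e^{iy}`. -/
def rho (x y : ℝ) : ℝ := ‖cis x - cis y‖

theorem rho_nonneg (x y : ℝ) : 0 ≤ rho x y := norm_nonneg _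

theorem rho_comm (x y : ℝ) : rho x y = rho y x := norm_sub_rev _ _

theorem rho_triangle (x y z : ℝ) : rho x z ≤ rho x y + rho y z :=
  norm_sub_le_norm_sub_add_norm_sub _ _ _

theorem rho_eq_norm_one_sub (x y : ℝ) : rho x y = ‖1 - cis (x - y)‖ := by
  have h : cis y - cis x = (1 - cis (x - y)) * cis y := by
    rw [sub_mul, cis_sub_mul, one_mul]
  rw [rho_comm, rho, h, norm_mul, norm_cis, mul_one]

theorem rho_add_right (x y z : ℝ) : rho (x + z) (y + z) = rho x y := by
  rw [rho_eq_norm_one_sub, rho_eq_norm_one_sub x, add_sub_add_right_eq_sub]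

theorem rho_eq_sin (x y : ℝ) : rho x y = 2 * |Real.sin ((x - y) / 2)| := by
  rw [rho_eq_norm_one_sub, norm_sub_rev, cis, Complex.norm_exp_I_mul_ofReal_sub_one, norm_mul]
  simp

theorem rho_le_abs (x y : ℝ) : rho x y ≤ |x - y| := by
  rw [rho_eq_norm_one_sub, norm_sub_rev, cis]
  exact Real.norm_exp_I_mul_ofReal_sub_one_le

theorem rho_add_two_pi (x y : ℝ) : rho (x + 2 * Real.pi) y = rho x y := by
  rw [rho, cis_add, cis_two_pi, mul_one, rho]

theorem le_rho {x y : ℝ} (h : |x - y| ≤ Real.pi) : 2 / Real.pi * |x - y| ≤ rho x y := by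
  rw [rho_eq_sin]
  have h2 : |(x - y) / 2| = |x - y| / 2 := by rw [abs_div, abs_two]
  have := Real.mul_abs_le_abs_sin (x := (x - y) / 2) (by rw [h2]; linarith)
  rw [h2] at this
  linarith

theorem continuous_rho_left (y : ℝ) : Continuous fun x => rho x y :=
  (continuous_cis.sub continuous_const).norm

/-- The bump of height one and width `a` around `y`. -/
def phi (a x y : ℝ) : ℝ := a ^ 2 / (rho x y ^ 2 + a ^ 2)

theorem phi_comm (a x y : ℝ) : phi a x y = phi a y x := by rw [phi, rho_comm, phi]

theorem phi_den_pos {a : ℝ} (ha : 0 < a) (x y : ℝ) : 0 < rho x y ^ 2 + a ^ 2 := by positivity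

theorem phi_nonneg (a x y : ℝ) : 0 ≤ phi a x y := by unfold phi; positivity

theorem phi_le_one {a : ℝ} (ha : 0 < a) (x y : ℝ) : phi a x y ≤ 1 := by
  rw [phi, div_le_one (phi_den_pos ha x y)]
  nlinarith [sq_nonneg (rho x y)]

theorem phi_mono {a b : ℝ} (ha : 0 < a) (hab : a ≤ b) (x y : ℝ) : phi a x y ≤ phi b x y := by
  have hb := ha.trans_le hab
  rw [phi, phi, div_le_div_iff₀ (phi_den_pos ha x y) (phi_den_pos hb x y)]
  have : a ^ 2 ≤ b ^ 2 := by gcongr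
  nlinarith [mul_le_mul_of_nonneg_right this (sq_nonneg (rho x y))]

theorem continuous_phi_left {a : ℝ} (ha : 0 < a) (y : ℝ) : Continuous fun x => phi a x y := by
  unfold phi
  exact continuous_const.div (((continuous_rho_left y).pow 2).add continuous_const)
    fun x => (phi_den_pos ha x y).ne'

theorem continuous_phi {a : ℝ} (ha : 0 < a) :
    Continuous fun p : ℝ × ℝ => phi a p.1 p.2 := by
  unfold phi rho
  refine continuous_const.div (((((continuous_cis.comp continuous_fst).sub
    (continuous_cis.comp continuous_snd)).norm).pow 2).add continuous_const) fun p => ?_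
  exact (phi_den_pos ha p.1 p.2).ne'

/-- The bump of width `a` varies by at most a factor three at distances at most `a`. -/
theorem phi_le_three_mul {a x x' : ℝ} (ha : 0 < a) (h : rho x x' ≤ a) (y : ℝ) :
    phi a x y ≤ 3 * phi a x' y := by
  rw [phi, phi, ← mul_div_assoc, div_le_div_iff₀ (phi_den_pos ha x y) (phi_den_pos ha x' y)]
  have h1 : rho x' y ≤ a + rho x y := by
    have := rho_triangle x' x y
    rw [rho_comm x' x] at this
    linarith
  have h2 : rho x' y ^ 2 ≤ 2 * a ^ 2 + 2 * rho x y ^ 2 := by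
    nlinarith [rho_nonneg x' y, rho_nonneg x y, sq_nonneg (a - rho x y)]
  nlinarith [sq_nonneg a, sq_nonneg (rho x y)]

theorem integrableOn_T_of_continuous {E : Type*} [NormedAddCommGroup E] {g : ℝ → E}
    (hg : Continuous g) : IntegrableOn g T :=
  (hg.integrableOn_Icc (a := -Real.pi) (b := Real.pi)).mono_set Set.Ico_subset_Icc_self

theorem measurableSet_T : MeasurableSet T := measurableSet_Ico

theorem integral_T {E : Type*} [NormedAddCommGroup E] [NormedSpace ℝ E] (g : ℝ → E) :
    ∫ x in T, g x = ∫ x in (-Real.pi)..Real.pi, g x := by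
  rw [T, integral_Ico_eq_integral_Ioc,
    intervalIntegral.integral_of_le (neg_lt_self Real.pi_pos).le]

theorem volume_T_lt_top : volume T < ⊤ := by
  rw [T, Real.volume_Ico]; exact ENNReal.ofReal_lt_top

instance : IsFiniteMeasure (volume.restrict T) :=
  ⟨by rw [Measure.restrict_apply_univ]; exact volume_T_lt_top⟩

theorem volume_real_T : volume.real T = 2 * Real.pi := by
  rw [T, Real.volume_real_Ico_of_le (neg_lt_self Real.pi_pos).le]; ring

theorem integral_phi_zero_le {a : ℝ} (ha : 0 < a) : ∫ x in T, phi a x 0 ≤ 5 * a := by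
  have hpi := Real.pi_pos
  -- Jordan's inequality `rho x 0 ≥ (2/π)|x|` dominates the bump by `1/(1 + (c x)²)`, whose integral
  -- `π/c = π² a / 2` is at most `5a`.
  set c : ℝ := 2 / (Real.pi * a) with hc
  have hc0 : 0 < c := by positivity
  have hint : Integrable fun x : ℝ => (1 + (c * x) ^ 2)⁻¹ :=
    integrable_inv_one_add_sq.comp_mul_left' hc0.ne'
  calc ∫ x in T, phi a x 0 ≤ ∫ x in T, (1 + (c * x) ^ 2)⁻¹ := by
        refine setIntegral_mono_on (integrableOn_T_of_continuous (continuous_phi_left ha 0))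
          hint.integrableOn measurableSet_T fun x hx => ?_
        have hx' : |x - 0| ≤ Real.pi := by
          rw [sub_zero, abs_le]; exact ⟨hx.1, hx.2.le⟩
        have h1 := le_rho hx'
        rw [sub_zero] at h1
        have h2 : (2 / Real.pi * |x|) ^ 2 ≤ rho x 0 ^ 2 := by gcongr
        rw [phi, ← one_div, div_le_div_iff₀ (phi_den_pos ha x 0) (by positivity)]
        have h3 : a ^ 2 * (c * x) ^ 2 = (2 / Real.pi * |x|) ^ 2 := by
          rw [mul_pow, mul_pow, sq_abs, hc]; field_simp
        nlinarith
    _ ≤ ∫ x : ℝ, (1 + (c * x) ^ 2)⁻¹ :=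
        setIntegral_le_integral hint (Filter.Eventually.of_forall fun x => by positivity)
    _ = c⁻¹ * Real.pi := by
        rw [Measure.integral_comp_mul_left (fun x : ℝ => (1 + x ^ 2)⁻¹) c,
          integral_univ_inv_one_add_sq, abs_of_pos (by positivity), smul_eq_mul]
    _ ≤ 5 * a := by
        rw [hc, inv_div]
        have : Real.pi ^ 2 ≤ 10 := by nlinarith [Real.pi_lt_d2]
        nlinarith

theorem integral_T_shift {g : ℝ → ℝ} (hg : Function.Periodic g (2 * Real.pi)) (y : ℝ) :
    ∫ x in T, g (x - y) = ∫ x in T, g x := by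
  rw [integral_T, integral_T, intervalIntegral.integral_comp_sub_right]
  have h := hg.intervalIntegral_add_eq (-Real.pi - y) (-Real.pi)
  rw [show -Real.pi - y + 2 * Real.pi = Real.pi - y by ring,
    show -Real.pi + 2 * Real.pi = Real.pi by ring] at h
  exact h

theorem integral_phi_le {a : ℝ} (ha : 0 < a) (y : ℝ) : ∫ x in T, phi a x y ≤ 5 * a := by
  have hper : Function.Periodic (fun x => phi a x 0) (2 * Real.pi) := fun x => by
    simp only [phi, rho_add_two_pi]
  have h := integral_T_shift hper y
  have h2 : ∀ x, phi a (x - y) 0 = phi a x y := fun x => by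
    have := rho_add_right (x - y) 0 y
    rw [sub_add_cancel, zero_add] at this
    rw [phi, phi, this]
  simp only [h2] at h
  rw [h]
  exact integral_phi_zero_le ha

/-- A point `y` cannot be close to both `u` and `v`: either `u` and `v` are within `a`, or `y` is at
least half their distance away from one of them. In each case one of the two bumps at `y` is
controlled by the wide bump between the centres. The factor `b / a` appears when it is the narrow
one. -/
theorem phi_mul_phi_le {a b : ℝ} (hb : 0 < b) (hab : b ≤ a) (u v y : ℝ) :
    phi a y u * phi b y v ≤
      4 * phi a u v * phi b y v + 4 * (b / a) * phi a u v * phi a y u := by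
  have ha := hb.trans_le hab
  have hA := phi_nonneg a y u
  have hB := phi_nonneg b y v
  have hD := phi_nonneg a u v
  have hA1 := phi_le_one ha y u
  have hba : 0 ≤ b / a := by positivity
  have key : phi a y u ≤ 4 * phi a u v ∨ phi b y v ≤ 4 * (b / a) * phi a u v := by
    rcases le_or_gt (rho u v) a with h | h
    · left
      have : 1 / 2 ≤ phi a u v := by
        rw [phi, div_le_div_iff₀ two_pos (phi_den_pos ha u v)]
        nlinarith [rho_nonneg u v]
      linarith
    · have htri := rho_triangle u y v
      rw [rho_comm u y] at htri
      have h0 := rho_nonneg u v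
      rcases le_or_gt (rho u v / 2) (rho y u) with h1 | h1
      · left
        rw [phi, phi, ← mul_div_assoc,
          div_le_div_iff₀ (phi_den_pos ha y u) (phi_den_pos ha u v)]
        have : (rho u v / 2) ^ 2 ≤ rho y u ^ 2 := by gcongr
        nlinarith [sq_nonneg a]
      · right
        have h2 : rho u v / 2 ≤ rho y v := by linarith
        have h3 : (rho u v / 2) ^ 2 ≤ rho y v ^ 2 := by gcongr
        have h4 : 4 * (b / a) * phi a u v = 4 * b * a / (rho u v ^ 2 + a ^ 2) := by
          rw [phi]; field_simp
        rw [h4, phi, div_le_div_iff₀ (phi_den_pos hb y v) (phi_den_pos ha u v)]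
        have h5 : a ^ 2 ≤ rho u v ^ 2 := by gcongr
        have h6 : b * (rho u v ^ 2 + a ^ 2) ≤ a * (4 * rho y v ^ 2 + 4 * b ^ 2) := by
          have : b * a ^ 2 + b * rho u v ^ 2 ≤ a * rho u v ^ 2 + a * b ^ 2 := by
            nlinarith [mul_nonneg (sub_nonneg.2 hab) (sub_nonneg.2 h5),
              mul_nonneg (sub_nonneg.2 hab) (mul_pos ha ha).le,
              mul_nonneg (sub_nonneg.2 hab) (mul_nonneg ha.le (sub_nonneg.2 hab))]
          nlinarith [mul_pos ha (sq_pos_of_pos hb)]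
        nlinarith
  rcases key with h | h
  · have := mul_le_mul_of_nonneg_right h hB
    have h' : 0 ≤ 4 * (b / a) * phi a u v * phi a y u := by positivity
    linarith
  · have := mul_le_mul_of_nonneg_right h hA
    have h' : 0 ≤ 4 * phi a u v * phi b y v := by positivity
    linarith

theorem integral_phi_mul_phi_le {a b : ℝ} (hb : 0 < b) (hab : b ≤ a) (u v : ℝ) :
    ∫ y in T, phi a y u * phi b y v ≤ 40 * b * phi a u v := by
  have ha := hb.trans_le hab
  have i1 := integrableOn_T_of_continuous (continuous_phi_left ha u)
  have i2 := integrableOn_T_of_continuous (continuous_phi_left hb v)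
  calc ∫ y in T, phi a y u * phi b y v
      ≤ ∫ y in T, (4 * phi a u v * phi b y v + 4 * (b / a) * phi a u v * phi a y u) :=
        integral_mono (integrableOn_T_of_continuous
          ((continuous_phi_left ha u).mul (continuous_phi_left hb v)))
          ((i2.const_mul _).add (i1.const_mul _)) fun y => phi_mul_phi_le hb hab u v y
    _ = 4 * phi a u v * (∫ y in T, phi b y v) +
          4 * (b / a) * phi a u v * (∫ y in T, phi a y u) := by
        rw [integral_add (i2.const_mul _) (i1.const_mul _), integral_const_mul,
          integral_const_mul]
    _ ≤ 4 * phi a u v * (5 * b) + 4 * (b / a) * phi a u v * (5 * a) := by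
        have hD := phi_nonneg a u v
        gcongr
        · exact integral_phi_le hb v
        · exact integral_phi_le ha u
    _ = 40 * b * phi a u v := by field_simp; ring

/-! ### Trigonometric polynomials -/

/-- The character `y ↦ e^{iky}`. -/
def ex (k : ℤ) (y : ℝ) : ℂ := Complex.exp (Complex.I * k * y)

theorem ex_eq_cis (k : ℤ) (y : ℝ) : ex k y = cis (k * y) := by
  rw [ex, cis]; push_cast; ring_nf

theorem norm_ex (k : ℤ) (y : ℝ) : ‖ex k y‖ = 1 := by rw [ex_eq_cis, norm_cis]

@[fun_prop]
theorem continuous_ex (k : ℤ) : Continuous (ex k) := by unfold ex; fun_prop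

theorem ex_add (k l : ℤ) (y : ℝ) : ex (k + l) y = ex k y * ex l y := by
  simp only [ex_eq_cis, ← cis_add]; push_cast; ring_nf

theorem ex_zero (y : ℝ) : ex 0 y = 1 := by simp [ex]

theorem conj_ex (k : ℤ) (y : ℝ) : (starRingEnd ℂ) (ex k y) = ex (-k) y := by
  rw [ex, ex, ← Complex.exp_conj]
  congr 1
  simp

theorem ex_natCast (k : ℕ) (y : ℝ) : ex k y = cis y ^ k := by
  rw [ex, cis, ← Complex.exp_nat_mul]; push_cast; ring_nf

theorem ex_sub_apply (k : ℤ) (x y : ℝ) : ex k (y - x) = ex k y * ex (-k) x := by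
  simp only [ex_eq_cis, ← cis_add]; push_cast; ring_nf

theorem integral_ex (k : ℤ) :
    ∫ y in T, ex k y = if k = 0 then 2 * (Real.pi : ℂ) else 0 := by
  split_ifs with hk
  · subst hk
    simp only [ex_zero, setIntegral_const, volume_real_T]
    simp
  · rw [integral_T]
    have hc : Complex.I * (k : ℂ) ≠ 0 := by simp [hk]
    simp only [ex]
    rw [integral_exp_mul_complex hc]
    have h : Complex.exp (Complex.I * k * (Real.pi : ℝ)) =
        Complex.exp (Complex.I * k * ((-Real.pi : ℝ) : ℂ)) := by
      rw [Complex.exp_eq_exp_iff_exists_int]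
      exact ⟨k, by push_cast; ring⟩
    rw [h, sub_self, zero_div]

theorem coeff_eq (f : ℝ → ℂ) (k : ℤ) :
    coeff f k = 1 / (2 * Real.pi) * ∫ x in T, f x * ex (-k) x := by
  rw [coeff_eq_integral]
  congr 1
  refine integral_congr_ae (Filter.Eventually.of_forall fun x => ?_)
  simp only [ex]
  congr 2
  push_cast; ring

theorem integrableOn_mul_ex {f : ℝ → ℂ} {s : Set ℝ} (hf : IntegrableOn f s) (k : ℤ) :
    IntegrableOn (fun x => f x * ex k x) s :=
  hf.mul_bdd (c := 1) (continuous_ex k).aestronglyMeasurable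
    (Filter.Eventually.of_forall fun x => (norm_ex k x).le)

theorem partialSum_eq (n : ℕ) (f : ℝ → ℂ) (y : ℝ) :
    partialSum n f y = ∑ k ∈ Finset.Icc (-(n : ℤ)) n, coeff f k * ex k y := rfl

/-- Parseval's identity for trigonometric polynomials. -/
theorem integral_normSq_sum_ex {ι : Type*} (s : Finset ι) (c : ι → ℂ) (κ : ι → ℤ)
    (hκ : Set.InjOn κ s) :
    ∫ y in T, ‖∑ k ∈ s, c k * ex (κ k) y‖ ^ 2 = 2 * Real.pi * ∑ k ∈ s, ‖c k‖ ^ 2 := by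
  have h1 : ∀ y, ((‖∑ k ∈ s, c k * ex (κ k) y‖ ^ 2 : ℝ) : ℂ) =
      ∑ k ∈ s, ∑ l ∈ s, (c k * (starRingEnd ℂ) (c l)) * ex (κ k - κ l) y := fun y => by
    rw [Complex.ofReal_pow, ← Complex.mul_conj', map_sum, Finset.sum_mul_sum]
    refine Finset.sum_congr rfl fun k _ => Finset.sum_congr rfl fun l _ => ?_
    rw [map_mul, conj_ex, sub_eq_add_neg, ex_add]; ring
  have h2 : ((∫ y in T, ‖∑ k ∈ s, c k * ex (κ k) y‖ ^ 2 : ℝ) : ℂ) =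
      ((2 * Real.pi * ∑ k ∈ s, ‖c k‖ ^ 2 : ℝ) : ℂ) := by
    rw [← integral_complex_ofReal]
    simp only [h1]
    have hi : ∀ k l, IntegrableOn
        (fun y => (c k * (starRingEnd ℂ) (c l)) * ex (κ k - κ l) y) T := fun k l =>
      integrableOn_T_of_continuous (by fun_prop)
    rw [integral_finsetSum _ fun k _ => integrable_finsetSum _ fun l _ => hi k l]
    push_cast
    rw [Finset.mul_sum]
    refine Finset.sum_congr rfl fun k hk => ?_
    rw [integral_finsetSum _ fun l _ => hi k l, Finset.sum_eq_single_of_mem k hk]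
    · rw [integral_const_mul, integral_ex, sub_self, if_pos rfl, Complex.mul_conj']
      ring
    · intro l hl hlk
      rw [integral_const_mul, integral_ex, if_neg, mul_zero]
      rw [sub_eq_zero]
      exact fun h => hlk (hκ hl hk h.symm)
  exact_mod_cast h2

/-- The trigonometric polynomials with frequencies in `S`. -/
def trigSpan (S : Set ℤ) : Submodule ℂ (ℝ → ℂ) := Submodule.span ℂ (ex '' S)

theorem ex_mem_trigSpan {S : Set ℤ} {k : ℤ} (hk : k ∈ S) : ex k ∈ trigSpan S :=
  Submodule.subset_span ⟨k, hk, rfl⟩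

theorem trigSpan_mono {S S' : Set ℤ} (h : S ⊆ S') : trigSpan S ≤ trigSpan S' :=
  Submodule.span_mono (Set.image_mono h)

theorem continuous_of_mem_trigSpan {S : Set ℤ} {g : ℝ → ℂ} (hg : g ∈ trigSpan S) :
    Continuous g := by
  induction hg using Submodule.span_induction with
  | mem x hx => obtain ⟨k, -, rfl⟩ := hx; exact continuous_ex k
  | zero => exact continuous_const
  | add x y _ _ hx hy => exact hx.add hy
  | smul a x _ hx => exact continuous_const.mul hx

theorem mul_mem_trigSpan {S S' R : Set ℤ} {g h : ℝ → ℂ} (hg : g ∈ trigSpan S)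
    (hh : h ∈ trigSpan S') (hR : ∀ k ∈ S, ∀ l ∈ S', k + l ∈ R) : g * h ∈ trigSpan R := by
  have := Submodule.mul_mem_mul hg hh
  rw [trigSpan, trigSpan, Submodule.span_mul_span] at this
  refine Submodule.span_mono ?_ this
  rintro _ ⟨_, ⟨k, hk, rfl⟩, _, ⟨l, hl, rfl⟩, rfl⟩
  exact ⟨k + l, hR k hk l hl, funext fun y => ex_add k l y⟩

theorem integral_mul_conj_eq_zero {S S' : Set ℤ} (hd : Disjoint S S') {g h : ℝ → ℂ}
    (hg : g ∈ trigSpan S) (hh : h ∈ trigSpan S') :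
    ∫ y in T, g y * (starRingEnd ℂ) (h y) = 0 := by
  have hconj : ∀ u : ℝ → ℂ, Continuous u → Continuous fun y => (starRingEnd ℂ) (u y) :=
    fun u hu => Complex.continuous_conj.comp hu
  have key : ∀ k ∈ S, ∫ y in T, ex k y * (starRingEnd ℂ) (h y) = 0 := by
    intro k hk
    induction hh using Submodule.span_induction with
    | mem x hx =>
      obtain ⟨l, hl, rfl⟩ := hx
      simp only [conj_ex, ← ex_add]
      rw [integral_ex, if_neg]
      intro h0
      refine Set.disjoint_left.1 hd hk ?_
      rwa [show k = l by omega]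
    | zero => simp
    | add x y hx hy ihx ihy =>
      simp only [Pi.add_apply, map_add, mul_add]
      rw [integral_add, ihx, ihy, add_zero]
      · exact integrableOn_T_of_continuous
          ((continuous_ex k).mul (hconj _ (continuous_of_mem_trigSpan hx)))
      · exact integrableOn_T_of_continuous
          ((continuous_ex k).mul (hconj _ (continuous_of_mem_trigSpan hy)))
    | smul a x hx ih =>
      simp only [Pi.smul_apply, smul_eq_mul, map_mul, mul_left_comm _ ((starRingEnd ℂ) a)]
      rw [integral_const_mul, ih, mul_zero]
  have hhc := hconj _ (continuous_of_mem_trigSpan hh)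
  induction hg using Submodule.span_induction with
  | mem x hx => obtain ⟨k, hk, rfl⟩ := hx; exact key k hk
  | zero => simp
  | add x y hx hy ihx ihy =>
    simp only [Pi.add_apply, add_mul]
    rw [integral_add, ihx, ihy, add_zero]
    · exact integrableOn_T_of_continuous ((continuous_of_mem_trigSpan hx).mul hhc)
    · exact integrableOn_T_of_continuous ((continuous_of_mem_trigSpan hy).mul hhc)
  | smul a x hx ih =>
    simp only [Pi.smul_apply, smul_eq_mul, mul_assoc]
    rw [integral_const_mul, ih, mul_zero]

theorem integral_normSq_sum_of_orthogonal {ι : Type*} (s : Finset ι) (g : ι → ℝ → ℂ)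
    (hc : ∀ i ∈ s, Continuous (g i))
    (ho : ∀ i ∈ s, ∀ j ∈ s, i ≠ j → ∫ y in T, g i y * (starRingEnd ℂ) (g j y) = 0) :
    l2NormSq (fun y => ∑ i ∈ s, g i y) = ∑ i ∈ s, l2NormSq (g i) := by
  have hi : ∀ i ∈ s, ∀ j ∈ s, IntegrableOn (fun y => g i y * (starRingEnd ℂ) (g j y)) T :=
    fun i h j h' => integrableOn_T_of_continuous
      ((hc i h).mul (Complex.continuous_conj.comp (hc j h')))
  have h2 : ((l2NormSq (fun y => ∑ i ∈ s, g i y) : ℝ) : ℂ) =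
      ((∑ i ∈ s, l2NormSq (g i) : ℝ) : ℂ) := by
    simp only [l2NormSq]
    push_cast
    simp only [← integral_complex_ofReal]
    have h1 : ∀ y, ((‖∑ i ∈ s, g i y‖ ^ 2 : ℝ) : ℂ) =
        ∑ i ∈ s, ∑ j ∈ s, g i y * (starRingEnd ℂ) (g j y) := fun y => by
      rw [Complex.ofReal_pow, ← Complex.mul_conj', map_sum, Finset.sum_mul_sum]
    simp only [h1]
    rw [integral_finsetSum _ fun i hi' => integrable_finsetSum _ fun j hj => hi i hi' j hj]
    refine Finset.sum_congr rfl fun i hi' => ?_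
    rw [integral_finsetSum _ fun j hj => hi i hi' j hj, Finset.sum_eq_single_of_mem i hi']
    · refine integral_congr_ae (Filter.Eventually.of_forall fun y => ?_)
      simp only [Complex.mul_conj', Complex.ofReal_pow]
    · exact fun j hj hji => ho i hi' j hj hji.symm
  exact_mod_cast h2

/-! ### The spectrum of `S_n f - V_n f` -/

theorem sum_Icc_neg_eq {M : Type*} [AddCommMonoid M] (F : ℤ → M) (l : ℕ) :
    ∑ k ∈ Finset.Icc (-(l : ℤ)) l, F k =
      F 0 + ∑ k ∈ Finset.range l, (F (k + 1) + F (-(k + 1))) := by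
  induction l with
  | zero => simp
  | succ l ih =>
    have h : Finset.Icc (-((l + 1 : ℕ) : ℤ)) ((l + 1 : ℕ) : ℤ) =
        insert ((l : ℤ) + 1) (insert (-((l : ℤ) + 1)) (Finset.Icc (-(l : ℤ)) l)) := by
      ext k; simp only [Finset.mem_Icc, Finset.mem_insert]; push_cast; omega
    rw [h, Finset.sum_insert, Finset.sum_insert, ih, Finset.sum_range_succ]
    · ac_rfl
    · simp only [Finset.mem_Icc]; omega
    · simp only [Finset.mem_Icc, Finset.mem_insert]; omega

theorem sum_range_sum_range {R : Type*} [CommRing R] (v : ℕ → R) (n : ℕ) :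
    ∑ i ∈ Finset.range n, ∑ k ∈ Finset.range i, v k =
      ∑ k ∈ Finset.range n, ((n : R) - (k + 1)) * v k := by
  induction n with
  | zero => simp
  | succ n ih =>
    rw [Finset.sum_range_succ, ih, Finset.sum_range_succ _ n, ← Finset.sum_add_distrib]
    push_cast
    rw [sub_self, zero_mul, add_zero]
    exact Finset.sum_congr rfl fun k _ => by ring

/-- The weight of the frequency `n + (k + 1)` in `V_n f - S_n f`. -/
def wt (n k : ℕ) : ℝ := ((n : ℝ) - (k + 1)) / n

theorem wt_nonneg {n k : ℕ} (h : k < n) : 0 ≤ wt n k := by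
  have : (k : ℝ) + 1 ≤ n := by exact_mod_cast h
  exact div_nonneg (by linarith) (Nat.cast_nonneg n)

theorem wt_le_one (n k : ℕ) : wt n k ≤ 1 :=
  div_le_one_of_le₀ (by linarith [(Nat.cast_nonneg k : (0 : ℝ) ≤ k)]) (Nat.cast_nonneg n)

theorem norm_wt_le_one {n k : ℕ} (h : k < n) : ‖(wt n k : ℂ)‖ ≤ 1 := by
  rw [Complex.norm_real, Real.norm_of_nonneg (wt_nonneg h)]
  exact wt_le_one n k

/-- The part of `V_n f - S_n f` with positive frequencies. -/
def posPart (n : ℕ) (f : ℝ → ℂ) (y : ℝ) : ℂ :=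
  ∑ k ∈ Finset.range n, wt n k * coeff f (n + (k + 1)) * ex (n + (k + 1)) y

/-- The part of `V_n f - S_n f` with negative frequencies. -/
def negPart (n : ℕ) (f : ℝ → ℂ) (y : ℝ) : ℂ :=
  ∑ k ∈ Finset.range n, wt n k * coeff f (-(n + (k + 1))) * ex (-(n + (k + 1))) y

/-- In the average of `S_n, …, S_{2n-1}`, the frequencies `±(n + k + 1)` occur in `n - (k + 1)` of
the `n` partial sums, while those up to `n` occur in all of them and cancel against `S_n`. -/
theorem partialSum_sub_vpMean {n : ℕ} (hn : 1 ≤ n) (f : ℝ → ℂ) (y : ℝ) :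
    partialSum n f y - vpMean n f y = -(posPart n f y + negPart n f y) := by
  have hn0 : (n : ℂ) ≠ 0 := by exact_mod_cast (by omega : n ≠ 0)
  set v : ℕ → ℂ := fun k => coeff f (n + (k + 1)) * ex (n + (k + 1)) y +
    coeff f (-(n + (k + 1))) * ex (-(n + (k + 1))) y with hv
  have hS : ∀ i, partialSum (n + i) f y = partialSum n f y + ∑ k ∈ Finset.range i, v k := by
    intro i
    rw [partialSum_eq, partialSum_eq, sum_Icc_neg_eq, sum_Icc_neg_eq, Finset.sum_range_add,
      ← add_assoc]
    congr 1
  have hV : vpMean n f y = partialSum n f y +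
      1 / (n : ℂ) * ∑ k ∈ Finset.range n, ((n : ℂ) - (k + 1)) * v k := by
    rw [vpMean, Finset.sum_Ico_eq_sum_range, show 2 * n - n = n by omega]
    simp only [hS]
    rw [Finset.sum_add_distrib, sum_range_sum_range, Finset.sum_const, Finset.card_range,
      nsmul_eq_mul, mul_add, ← mul_assoc, one_div_mul_cancel hn0, one_mul]
  rw [hV, sub_add_cancel_left, posPart, negPart, ← Finset.sum_add_distrib, Finset.mul_sum]
  congr 1
  refine Finset.sum_congr rfl fun k _ => ?_
  rw [hv, wt]; push_cast; ring

/-- Lets every later estimate treat positive frequencies only, applied to `f` and to its conjugate,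
which have the same modulus. -/
theorem negPart_eq (n : ℕ) (f : ℝ → ℂ) (y : ℝ) :
    negPart n f y = (starRingEnd ℂ) (posPart n (fun x => (starRingEnd ℂ) (f x)) y) := by
  rw [negPart, posPart, map_sum]
  refine Finset.sum_congr rfl fun k _ => ?_
  rw [map_mul, map_mul, conj_ex, Complex.conj_ofReal]
  congr 2
  rw [coeff_eq, coeff_eq, map_mul, ← integral_conj]
  simp only [map_mul, conj_ex, Complex.conj_conj]
  congr 1
  simp [Complex.conj_ofNat]

theorem posPart_mem (n : ℕ) (f : ℝ → ℂ) :
    posPart n f ∈ trigSpan {k | (n : ℤ) < |k| ∧ |k| ≤ 2 * n} := by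
  have h : posPart n f = ∑ k ∈ Finset.range n,
      ((wt n k : ℂ) * coeff f (n + (k + 1))) • ex (n + (k + 1)) := by
    ext y; simp [posPart]
  rw [h]
  refine Submodule.sum_mem _ fun k hk => Submodule.smul_mem _ _ (ex_mem_trigSpan ?_)
  have := Finset.mem_range.1 hk
  rw [Set.mem_ofPred_eq, abs_of_nonneg (by positivity)]
  omega

theorem negPart_mem (n : ℕ) (f : ℝ → ℂ) :
    negPart n f ∈ trigSpan {k | (n : ℤ) < |k| ∧ |k| ≤ 2 * n} := by
  have h : negPart n f = ∑ k ∈ Finset.range n,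
      ((wt n k : ℂ) * coeff f (-(n + (k + 1)))) • ex (-(n + (k + 1))) := by
    ext y; simp [negPart]
  rw [h]
  refine Submodule.sum_mem _ fun k hk => Submodule.smul_mem _ _ (ex_mem_trigSpan ?_)
  have := Finset.mem_range.1 hk
  rw [Set.mem_ofPred_eq, abs_neg, abs_of_nonneg (by positivity)]
  omega

theorem partialSum_mem (n : ℕ) (f : ℝ → ℂ) : partialSum n f ∈ trigSpan {k | |k| ≤ n} := by
  have h : partialSum n f = ∑ k ∈ Finset.Icc (-(n : ℤ)) n, coeff f k • ex k := by
    ext y; simp [partialSum_eq]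
  rw [h]
  refine Submodule.sum_mem _ fun k hk => Submodule.smul_mem _ _ (ex_mem_trigSpan ?_)
  exact abs_le.2 (Finset.mem_Icc.1 hk)

theorem fejerMean_mem (m : ℕ) (f : ℝ → ℂ) : fejerMean m f ∈ trigSpan {k | |k| ≤ m} := by
  have h : fejerMean m f =
      (1 / ((m : ℂ) + 1)) • ∑ k ∈ Finset.range (m + 1), partialSum k f := by
    ext y; simp [fejerMean]
  rw [h]
  refine Submodule.smul_mem _ _ (Submodule.sum_mem _ fun k hk => ?_)
  refine trigSpan_mono (fun l hl => ?_) (partialSum_mem k f)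
  have := Finset.mem_range.1 hk
  simp only [Set.mem_ofPred_eq] at hl ⊢
  omega

theorem term_mem {n : ℕ → ℕ} {j : ℕ} (hn : 1 ≤ n j) (f : ℝ → ℂ) (lam : ℝ) (β : ℕ) :
    term f lam β n j ∈
      trigSpan {k | 9 * (n j : ℤ) < 10 * |k| ∧ 10 * |k| ≤ 21 * n j} := by
  have h : term f lam β n j = (-(posPart (n j) f + negPart (n j) f)) *
      fejerMean (n j / 10)
        ((T \ dilatedSet f lam β (threshold n j)).indicator fun _ => (1 : ℂ)) := by
    ext y
    simp only [term, partialSum_sub_vpMean hn, Pi.mul_apply, Pi.neg_apply, Pi.add_apply]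
  rw [h]
  refine mul_mem_trigSpan (Submodule.neg_mem _ (Submodule.add_mem _ (posPart_mem _ _)
    (negPart_mem _ _))) (fejerMean_mem _ _) ?_
  intro k hk l hl
  simp only [Set.mem_ofPred_eq] at hk hl ⊢
  push_cast at hl
  have h1 := abs_add_le k l
  have h2 : |k| ≤ |k + l| + |l| := by
    have := abs_sub (k + l) l
    rwa [add_sub_cancel_right] at this
  omega

/-- The bands do not meet because `9 n_j ≥ 22.5 n_i > 21 n_i`. -/
theorem term_orthogonal {n : ℕ → ℕ} {i j : ℕ} (hi : 1 ≤ n i) (hij : 5 * n i ≤ 2 * n j)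
    (f : ℝ → ℂ) (lam : ℝ) (β : ℕ) :
    ∫ y in T, term f lam β n i y * (starRingEnd ℂ) (term f lam β n j y) = 0 ∧
    ∫ y in T, term f lam β n j y * (starRingEnd ℂ) (term f lam β n i y) = 0 := by
  have hd : Disjoint {k : ℤ | 9 * (n i : ℤ) < 10 * |k| ∧ 10 * |k| ≤ 21 * n i}
      {k | 9 * (n j : ℤ) < 10 * |k| ∧ 10 * |k| ≤ 21 * n j} := by
    refine Set.disjoint_left.2 fun k hk hk' => ?_
    simp only [Set.mem_ofPred_eq] at hk hk'
    omega
  have hj : 1 ≤ n j := by omega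
  exact ⟨integral_mul_conj_eq_zero hd (term_mem hi _ _ _) (term_mem hj _ _ _),
    integral_mul_conj_eq_zero hd.symm (term_mem hj _ _ _) (term_mem hi _ _ _)⟩

/-! ### The Fejér kernel -/

/-- The Fejér kernel with `M` frequencies in its square root. -/
def fejer (M : ℕ) (t : ℝ) : ℝ := ‖∑ l ∈ Finset.range M, ex l t‖ ^ 2 / M

theorem fejer_nonneg (M : ℕ) (t : ℝ) : 0 ≤ fejer M t := by unfold fejer; positivity

@[fun_prop]
theorem continuous_fejer (M : ℕ) : Continuous (fejer M) := by unfold fejer; fun_prop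

theorem norm_sum_ex_sq (M : ℕ) (t : ℝ) :
    ((‖∑ l ∈ Finset.range M, ex l t‖ ^ 2 : ℝ) : ℂ) =
      ∑ l ∈ Finset.range M, ∑ l' ∈ Finset.range M, ex ((l' : ℤ) - l) t := by
  rw [Complex.ofReal_pow, ← Complex.conj_mul', map_sum, Finset.sum_mul_sum]
  refine Finset.sum_congr rfl fun k _ => Finset.sum_congr rfl fun l _ => ?_
  rw [conj_ex, sub_eq_add_neg, ex_add, mul_comm]

/-- Both sides count the frequency `j` with multiplicity `M - |j|`; the induction adds one row, one
column and a corner, which together form one Dirichlet kernel. -/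
theorem sum_dirichlet_eq (M : ℕ) (t : ℝ) :
    ∑ k ∈ Finset.range M, ∑ j ∈ Finset.Icc (-(k : ℤ)) k, ex j t =
      ∑ l ∈ Finset.range M, ∑ l' ∈ Finset.range M, ex ((l' : ℤ) - l) t := by
  induction M with
  | zero => simp
  | succ M ih =>
    have h1 : ∑ k ∈ Finset.range M, ex ((k : ℤ) + 1) t =
        ∑ l ∈ Finset.range M, ex ((M : ℤ) - l) t := by
      rw [← Finset.sum_range_reflect]
      refine Finset.sum_congr rfl fun l hl => ?_
      have := Finset.mem_range.1 hl
      congr 1; omega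
    have h2 : ∑ k ∈ Finset.range M, ex (-((k : ℤ) + 1)) t =
        ∑ l ∈ Finset.range M, ex ((l : ℤ) - M) t := by
      rw [← Finset.sum_range_reflect]
      refine Finset.sum_congr rfl fun l hl => ?_
      have := Finset.mem_range.1 hl
      congr 1; omega
    rw [Finset.sum_range_succ, ih, Finset.sum_range_succ _ M]
    simp only [Finset.sum_range_succ _ M]
    rw [Finset.sum_add_distrib, sum_Icc_neg_eq, Finset.sum_add_distrib, h1, h2, sub_self]
    ring

theorem fejerMean_eq_integral (m : ℕ) {g : ℝ → ℂ} (hg : IntegrableOn g T) (y : ℝ) :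
    fejerMean m g y =
      1 / (2 * Real.pi) * ∫ x in T, g x * (fejer (m + 1) (y - x) : ℂ) := by
  have h1 : ∀ x, g x * (fejer (m + 1) (y - x) : ℂ) = 1 / ((m : ℂ) + 1) *
      ∑ k ∈ Finset.range (m + 1), ∑ j ∈ Finset.Icc (-(k : ℤ)) k,
        g x * ex (-j) x * ex j y := fun x => by
    rw [fejer, Complex.ofReal_div, norm_sum_ex_sq, ← sum_dirichlet_eq, div_eq_mul_one_div,
      mul_comm _ (1 / _), mul_left_comm, Finset.mul_sum]
    push_cast
    congr 1
    refine Finset.sum_congr rfl fun k _ => ?_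
    rw [Finset.mul_sum]
    refine Finset.sum_congr rfl fun j _ => ?_
    rw [ex_sub_apply]; ring
  have hi : ∀ j : ℤ, IntegrableOn (fun x => g x * ex (-j) x * ex j y) T := fun j =>
    (integrableOn_mul_ex hg (-j)).mul_const _
  simp only [h1]
  rw [integral_const_mul, integral_finsetSum _ fun k _ => integrable_finsetSum _ fun j _ => hi j,
    fejerMean, mul_left_comm]
  congr 1
  rw [Finset.mul_sum]
  refine Finset.sum_congr rfl fun k _ => ?_
  rw [integral_finsetSum _ fun j _ => hi j, partialSum_eq, Finset.mul_sum]
  refine Finset.sum_congr rfl fun j _ => ?_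
  rw [integral_mul_const, coeff_eq]; ring

theorem integral_fejer {M : ℕ} (hM : 1 ≤ M) (y : ℝ) :
    ∫ x in T, fejer M (y - x) = 2 * Real.pi := by
  have hM0 : (M : ℝ) ≠ 0 := by exact_mod_cast (by omega : M ≠ 0)
  simp only [fejer, ex_sub_apply]
  rw [integral_div, integral_normSq_sum_ex (Finset.range M) (fun l => ex l y) (fun l => -(l : ℤ))
    (fun a _ b _ h => by simpa using h)]
  simp only [norm_ex, one_pow, Finset.sum_const, Finset.card_range, nsmul_eq_mul, mul_one]
  field_simp

theorem fejer_le (M : ℕ) (t : ℝ) : fejer M t ≤ M := by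
  have h : ‖∑ l ∈ Finset.range M, ex l t‖ ≤ M := by
    refine (norm_sum_le _ _).trans ?_
    simp [norm_ex]
  have h2 : ‖∑ l ∈ Finset.range M, ex l t‖ ^ 2 ≤ (M : ℝ) * M := by
    rw [← sq]; gcongr
  exact div_le_of_le_mul₀ (Nat.cast_nonneg M) (Nat.cast_nonneg M) h2

/-- The left side is `|1 - z^M|²` for `z` on the unit circle, by the geometric sum. -/
theorem fejer_mul_rho_sq_le {M : ℕ} (hM : 1 ≤ M) (x y : ℝ) :
    fejer M (y - x) * (M * rho x y ^ 2) ≤ 4 := by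
  have hM0 : (M : ℝ) ≠ 0 := by exact_mod_cast (by omega : M ≠ 0)
  have h1 : ‖∑ l ∈ Finset.range M, ex l (y - x)‖ * rho x y ≤ 2 := by
    simp only [ex_natCast]
    rw [rho_comm, rho_eq_norm_one_sub, ← norm_mul, mul_comm, mul_neg_geom_sum]
    refine (norm_sub_le _ _).trans ?_
    rw [norm_pow, norm_cis, norm_one, one_pow]; norm_num
  have h2 : fejer M (y - x) * (M * rho x y ^ 2) =
      (‖∑ l ∈ Finset.range M, ex l (y - x)‖ * rho x y) ^ 2 := by
    rw [fejer]; field_simp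
  rw [h2]
  have := rho_nonneg x y
  nlinarith [mul_nonneg (norm_nonneg (∑ l ∈ Finset.range M, ex l (y - x))) this]

theorem fejer_le_phi {M : ℕ} (hM : 1 ≤ M) (x y : ℝ) :
    fejer M (y - x) ≤ 8 * M * phi (1 / M) x y := by
  have hM0 : (0 : ℝ) < M := by exact_mod_cast hM
  have h1 := fejer_le M (y - x)
  have h2 := fejer_mul_rho_sq_le hM x y
  have h3 : phi (1 / M) x y = 1 / (M ^ 2 * rho x y ^ 2 + 1) := by
    rw [phi]; field_simp
  rw [h3, mul_one_div, le_div_iff₀ (by positivity)]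
  nlinarith

/-- A Fejér mean of an indicator function is bounded by one. -/
theorem norm_fejerMean_indicator_le_one (m : ℕ) {E : Set ℝ} (hE : MeasurableSet E) (y : ℝ) :
    ‖fejerMean m (E.indicator fun _ => (1 : ℂ)) y‖ ≤ 1 := by
  have hpi := Real.pi_pos
  have hi : IntegrableOn (E.indicator fun _ => (1 : ℂ)) T :=
    (integrableOn_T_of_continuous continuous_const).indicator hE
  rw [fejerMean_eq_integral m hi, norm_mul]
  have h1 : ‖∫ x in T, E.indicator (fun _ => (1 : ℂ)) x * (fejer (m + 1) (y - x) : ℂ)‖ ≤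
      2 * Real.pi := by
    rw [← integral_fejer (by omega : 1 ≤ m + 1) y]
    refine norm_integral_le_of_norm_le
      (integrableOn_T_of_continuous (by fun_prop)) (Filter.Eventually.of_forall fun x => ?_)
    rw [norm_mul, Complex.norm_real, Real.norm_of_nonneg (fejer_nonneg _ _)]
    refine mul_le_of_le_one_left (fejer_nonneg _ _) ?_
    refine (norm_indicator_le_norm_self _ _).trans ?_
    simp
  have h2 : ‖(1 / (2 * Real.pi) : ℂ)‖ = 1 / (2 * Real.pi) := by
    simp [abs_of_pos hpi]
  rw [h2, one_div, inv_mul_le_iff₀ (by positivity), mul_one]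
  exact h1

/-- A Fejér mean of the indicator function of a set decays away from the set. -/
theorem norm_fejerMean_indicator_le (m : ℕ) {E : Set ℝ} (hE : MeasurableSet E) {y a : ℝ}
    (ha : 0 < a) (hfar : ∀ x ∈ E, a / 2 ≤ rho x y) :
    ‖fejerMean m (E.indicator fun _ => (1 : ℂ)) y‖ ≤ 20 / ((m + 1 : ℕ) * a) := by
  have hpi := Real.pi_gt_three
  have hM : 1 ≤ m + 1 := by omega
  have hM0 : (0 : ℝ) < (m + 1 : ℕ) := by exact_mod_cast hM
  have hi : IntegrableOn (E.indicator fun _ => (1 : ℂ)) T :=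
    (integrableOn_T_of_continuous continuous_const).indicator hE
  rw [fejerMean_eq_integral m hi, norm_mul]
  have h1 : ‖∫ x in T, E.indicator (fun _ => (1 : ℂ)) x * (fejer (m + 1) (y - x) : ℂ)‖ ≤
      20 / ((m + 1 : ℕ) * a ^ 2) * (5 * a) := by
    refine (norm_integral_le_of_norm_le (g := fun x => 20 / ((m + 1 : ℕ) * a ^ 2) * phi a x y)
      ((integrableOn_T_of_continuous (continuous_phi_left ha y)).const_mul _)
      (Filter.Eventually.of_forall fun x => ?_)).trans ?_
    · by_cases hx : x ∈ E
      · rw [Set.indicator_of_mem hx, one_mul, Complex.norm_real,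
          Real.norm_of_nonneg (fejer_nonneg _ _)]
        have h2 := fejer_mul_rho_sq_le hM x y
        have h3 : (a / 2) ^ 2 ≤ rho x y ^ 2 := by
          have := hfar x hx
          gcongr
        have h4 : 20 / ((m + 1 : ℕ) * a ^ 2) * phi a x y =
            20 / ((m + 1 : ℕ) * (rho x y ^ 2 + a ^ 2)) := by
          rw [phi]; field_simp
        rw [h4, le_div_iff₀ (mul_pos hM0 (phi_den_pos ha x y))]
        have h5 := fejer_nonneg (m + 1) (y - x)
        have h6 : fejer (m + 1) (y - x) * (m + 1 : ℕ) * (rho x y ^ 2 + a ^ 2) ≤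
            fejer (m + 1) (y - x) * (m + 1 : ℕ) * (5 * rho x y ^ 2) := by
          gcongr
          nlinarith
        nlinarith
      · rw [Set.indicator_of_notMem hx, zero_mul, norm_zero]
        have := phi_nonneg a x y
        positivity
    · rw [integral_const_mul]
      gcongr
      exact integral_phi_le ha y
  have h2 : ‖(1 / (2 * Real.pi) : ℂ)‖ = 1 / (2 * Real.pi) := by
    simp [abs_of_pos Real.pi_pos]
  rw [h2, one_div, inv_mul_le_iff₀ (by positivity)]
  refine h1.trans ?_
  have h3 : 20 / ((m + 1 : ℕ) * a ^ 2) * (5 * a) = 5 * (20 / ((m + 1 : ℕ) * a)) := by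
    field_simp
  rw [h3]
  have : 0 ≤ 20 / ((m + 1 : ℕ) * a) := by positivity
  nlinarith

/-! ### The demodulated kernel -/

/-- The kernel of the positive part of `V_n - S_n`, demodulated by `e^{-inx}`. -/
def ker (n : ℕ) (z : ℂ) : ℂ := ∑ k ∈ Finset.range n, (wt n k : ℂ) * z ^ (k + 1)

/-- The operator with the kernel `ker n`. -/
def demod (n : ℕ) (h : ℝ → ℂ) (y : ℝ) : ℂ :=
  ∑ k ∈ Finset.range n, wt n k * coeff h (k + 1) * ex (k + 1) y

theorem continuous_ker (n : ℕ) : Continuous (ker n) := by unfold ker; fun_prop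

theorem continuous_demod (n : ℕ) (h : ℝ → ℂ) : Continuous (demod n h) := by
  unfold demod; fun_prop

/-- Modulation changes neither `|f|` nor the size of the output, so oscillation at frequency `n` is
removed at no cost; only after this does the kernel have smoothness bounds independent of `n`. -/
theorem posPart_eq_demod (n : ℕ) (f : ℝ → ℂ) (y : ℝ) :
    posPart n f y = ex n y * demod n (fun x => f x * ex (-n) x) y := by
  rw [posPart, demod, Finset.mul_sum]
  refine Finset.sum_congr rfl fun k _ => ?_
  rw [coeff_eq, coeff_eq, ex_add]
  have : ∀ x, f x * ex (-(n + (k + 1))) x = f x * ex (-n) x * ex (-(k + 1)) x := fun x => by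
    rw [neg_add, ex_add, mul_assoc]
  simp only [this]
  ring

theorem demod_eq_integral (n : ℕ) {h : ℝ → ℂ} (hh : IntegrableOn h T) (y : ℝ) :
    demod n h y = 1 / (2 * Real.pi) * ∫ x in T, h x * ker n (cis (y - x)) := by
  have h1 : ∀ x, h x * ker n (cis (y - x)) = ∑ k ∈ Finset.range n,
      h x * ex (-(k + 1)) x * (wt n k * ex (k + 1) y) := fun x => by
    rw [ker, Finset.mul_sum]
    refine Finset.sum_congr rfl fun k _ => ?_
    have := ex_natCast (k + 1) (y - x)
    rw [← this, ex_sub_apply]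
    push_cast; ring
  simp only [h1]
  rw [integral_finsetSum _ fun k _ => (integrableOn_mul_ex hh _).mul_const _, demod,
    Finset.mul_sum]
  refine Finset.sum_congr rfl fun k _ => ?_
  rw [integral_mul_const, coeff_eq]; ring

theorem norm_ker_le (n : ℕ) {z : ℂ} (hz : ‖z‖ ≤ 1) : ‖ker n z‖ ≤ n := by
  rw [ker]
  refine (norm_sum_le_of_le (f := fun k => (wt n k : ℂ) * z ^ (k + 1)) (Finset.range n)
    (n := fun _ => (1 : ℝ)) fun k hk => ?_).trans (by simp)
  rw [norm_mul, norm_pow]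
  exact mul_le_one₀ (norm_wt_le_one (Finset.mem_range.1 hk)) (by positivity)
    (pow_le_one₀ (norm_nonneg _) hz)

/-- Dividing by `n` shows that `1 + ker n z` equals `(1 - H z) / (1 - z)` away from `z = 1`, where
`H` is the average of `z, …, z^n`: a Cauchy kernel with a bounded correction. -/
theorem one_sub_mul_ker (n : ℕ) (z : ℂ) :
    (1 - z) * (n + ∑ k ∈ Finset.range n, ((n : ℂ) - (k + 1)) * z ^ (k + 1)) =
      n - ∑ k ∈ Finset.range n, z ^ (k + 1) := by
  induction n with
  | zero => simp
  | succ n ih =>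
    have h1 : ∑ k ∈ Finset.range (n + 1), (((n + 1 : ℕ) : ℂ) - (k + 1)) * z ^ (k + 1) =
        ∑ k ∈ Finset.range n, ((n : ℂ) - (k + 1)) * z ^ (k + 1) +
          ∑ k ∈ Finset.range n, z ^ (k + 1) := by
      rw [Finset.sum_range_succ, ← Finset.sum_add_distrib]
      push_cast
      rw [sub_self, zero_mul, add_zero]
      exact Finset.sum_congr rfl fun k _ => by ring
    have h2 := mul_neg_geom_sum z (n + 1)
    rw [Finset.sum_range_succ'] at h2
    rw [h1, Finset.sum_range_succ]
    push_cast
    linear_combination ih + h2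

theorem norm_pow_sub_pow_le {z w : ℂ} (hz : ‖z‖ ≤ 1) (hw : ‖w‖ ≤ 1) (k : ℕ) :
    ‖z ^ k - w ^ k‖ ≤ k * ‖z - w‖ := by
  induction k with
  | zero => simp
  | succ k ih =>
    have h : z ^ (k + 1) - w ^ (k + 1) = z * (z ^ k - w ^ k) + (z - w) * w ^ k := by ring
    have h1 : ‖z * (z ^ k - w ^ k)‖ ≤ k * ‖z - w‖ := by
      rw [norm_mul]
      exact (mul_le_of_le_one_left (norm_nonneg _) hz).trans ih
    have h2 : ‖(z - w) * w ^ k‖ ≤ ‖z - w‖ := by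
      rw [norm_mul, norm_pow]
      exact mul_le_of_le_one_right (norm_nonneg _) (pow_le_one₀ (norm_nonneg _) hw)
    rw [h]
    refine (norm_add_le _ _).trans ?_
    push_cast; linarith

/-- The kernel `ker n` satisfies Calderón–Zygmund regularity estimates uniformly in `n`. -/
theorem norm_ker_sub_ker_le {n : ℕ} (hn : 1 ≤ n) {z w : ℂ} (hz : ‖z‖ ≤ 1) (hw : ‖w‖ ≤ 1) :
    ‖ker n z - ker n w‖ * (‖1 - z‖ * ‖1 - w‖) ≤ 6 * ‖z - w‖ := by
  have hn1 : (1 : ℝ) ≤ n := by exact_mod_cast hn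
  have hn0 : (n : ℂ) ≠ 0 := by exact_mod_cast (by omega : n ≠ 0)
  set H : ℂ → ℂ := fun z => 1 / n * ∑ k ∈ Finset.range n, z ^ (k + 1) with hH
  have hker : ∀ z, (1 - z) * (1 + ker n z) = 1 - H z := fun z => by
    have h1 : 1 + ker n z =
        1 / n * (n + ∑ k ∈ Finset.range n, ((n : ℂ) - (k + 1)) * z ^ (k + 1)) := by
      rw [mul_add, one_div_mul_cancel hn0, ker, Finset.mul_sum]
      congr 1
      refine Finset.sum_congr rfl fun k _ => ?_
      rw [wt]; push_cast; ring
    rw [h1, mul_left_comm, one_sub_mul_ker, mul_sub, one_div_mul_cancel hn0]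
  have hH1 : ∀ z : ℂ, ‖z‖ ≤ 1 → ‖H z‖ ≤ 1 := fun z hz => by
    rw [hH]
    simp only [norm_mul, norm_div, norm_one, Complex.norm_natCast]
    rw [one_div, inv_mul_le_iff₀ (by linarith), mul_one]
    refine (norm_sum_le_of_le (f := fun k => z ^ (k + 1)) (Finset.range n)
      (n := fun _ => (1 : ℝ)) fun k _ => ?_).trans (by simp)
    rw [norm_pow]
    exact pow_le_one₀ (norm_nonneg _) hz
  have hHg : ∀ z, n * (H z * (1 - z)) = z - z ^ (n + 1) := fun z => by
    have h2 := mul_neg_geom_sum z n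
    have h3 : ∑ k ∈ Finset.range n, z ^ (k + 1) = z * ∑ k ∈ Finset.range n, z ^ k := by
      rw [Finset.mul_sum]; exact Finset.sum_congr rfl fun k _ => by ring
    simp only [hH, h3]
    field_simp
    linear_combination z * h2
  -- `H` alone has Lipschitz constant of order `n`. The factor `1 - z` telescopes the sum, and then
  -- the `n` from differentiating `z^(n+1)` is absorbed by the `1/n` in `H`; the total is `1 + (n+1)
  -- + n ≤ 4n`.
  have hHd : ‖H z - H w‖ * ‖1 - z‖ ≤ 4 * ‖z - w‖ := by
    have e1 : n * ((H z - H w) * (1 - z)) =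
        (z - w) - (z ^ (n + 1) - w ^ (n + 1)) + n * (H w * (z - w)) := by
      linear_combination hHg z - hHg w
    have e2 : (n : ℝ) * (‖H z - H w‖ * ‖1 - z‖) ≤
        ‖z - w‖ + (n + 1 : ℕ) * ‖z - w‖ + n * ‖z - w‖ := by
      rw [← norm_mul, ← Complex.norm_natCast n, ← norm_mul, e1, Complex.norm_natCast]
      refine (norm_add_le _ _).trans (add_le_add ((norm_sub_le _ _).trans
        (add_le_add_right (norm_pow_sub_pow_le hz hw _) _)) ?_)
      rw [norm_mul, Complex.norm_natCast, norm_mul]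
      gcongr
      exact mul_le_of_le_one_left (norm_nonneg _) (hH1 w hw)
    push_cast at e2
    have e3 : (n : ℝ) * (‖H z - H w‖ * ‖1 - z‖) ≤ n * (4 * ‖z - w‖) := by
      nlinarith [norm_nonneg (z - w)]
    exact le_of_mul_le_mul_left e3 (by linarith)
  have e5 : (ker n z - ker n w) * ((1 - z) * (1 - w)) =
      (1 - H z) * (z - w) - (H z - H w) * (1 - z) := by
    linear_combination (1 - w) * hker z - (1 - z) * hker w
  rw [← norm_mul, ← norm_mul, e5]
  refine (norm_sub_le _ _).trans ?_
  rw [norm_mul, norm_mul]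
  have e6 : ‖1 - H z‖ ≤ 2 := by
    refine (norm_sub_le _ _).trans ?_
    rw [norm_one]; linarith [hH1 z hz]
  nlinarith [norm_nonneg (z - w)]

/-! ### Bessel's inequality -/

theorem bessel {ι : Type*} (s : Finset ι) (κ : ι → ℤ) (hκ : Set.InjOn κ s) {h : ℝ → ℂ}
    (hh : IntegrableOn h T) (hh2 : IntegrableOn (fun x => ‖h x‖ ^ 2) T) :
    2 * Real.pi * ∑ k ∈ s, ‖coeff h (κ k)‖ ^ 2 ≤ ∫ x in T, ‖h x‖ ^ 2 := by
  set p : ℝ → ℂ := fun y => ∑ k ∈ s, coeff h (κ k) * ex (κ k) y with hp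
  have hpc : Continuous p := by rw [hp]; fun_prop
  have h1 : ∫ y in T, ‖p y‖ ^ 2 = 2 * Real.pi * ∑ k ∈ s, ‖coeff h (κ k)‖ ^ 2 :=
    integral_normSq_sum_ex s _ κ hκ
  have hpe : ∀ x, h x * (starRingEnd ℂ) (p x) =
      ∑ k ∈ s, (starRingEnd ℂ) (coeff h (κ k)) * (h x * ex (-κ k) x) := fun x => by
    rw [hp, map_sum, Finset.mul_sum]
    refine Finset.sum_congr rfl fun k _ => ?_
    rw [map_mul, conj_ex]; ring
  have hpi : IntegrableOn (fun x => h x * (starRingEnd ℂ) (p x)) T := by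
    simp only [hpe]
    exact integrable_finsetSum _ fun k _ => (integrableOn_mul_ex hh _).const_mul _
  have h2 : ∫ x in T, h x * (starRingEnd ℂ) (p x) =
      ((2 * Real.pi * ∑ k ∈ s, ‖coeff h (κ k)‖ ^ 2 : ℝ) : ℂ) := by
    simp only [hpe]
    rw [integral_finsetSum _ fun k _ => (integrableOn_mul_ex hh _).const_mul _]
    push_cast
    rw [Finset.mul_sum]
    refine Finset.sum_congr rfl fun k _ => ?_
    have h3 : ∫ x in T, h x * ex (-κ k) x = 2 * Real.pi * coeff h (κ k) := by
      rw [coeff_eq, ← mul_assoc, mul_one_div_cancel, one_mul]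
      exact_mod_cast Real.two_pi_pos.ne'
    rw [integral_const_mul, h3, ← Complex.conj_mul']; ring
  have h3 : ∫ x in T, (h x * (starRingEnd ℂ) (p x)).re =
      2 * Real.pi * ∑ k ∈ s, ‖coeff h (κ k)‖ ^ 2 := by
    have : ∫ x in T, (h x * (starRingEnd ℂ) (p x)).re =
        (∫ x in T, h x * (starRingEnd ℂ) (p x)).re := integral_re hpi
    rw [this, h2, Complex.ofReal_re]
  have hre : IntegrableOn (fun x => (h x * (starRingEnd ℂ) (p x)).re) T := hpi.re
  -- Expanding the square around the Fourier projection `p` gives `‖h‖² - 2‖p‖² + ‖p‖²`, since `⟨h,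
  -- p⟩ = ‖p‖²`.
  have h4 : 0 ≤ ∫ x in T, ‖h x - p x‖ ^ 2 := integral_nonneg fun x => by positivity
  have h5 : ∀ x, ‖h x - p x‖ ^ 2 =
      ‖h x‖ ^ 2 - 2 * (h x * (starRingEnd ℂ) (p x)).re + ‖p x‖ ^ 2 := fun x => by
    simp only [← Complex.normSq_eq_norm_sq, Complex.normSq_sub]; ring
  simp only [h5] at h4
  have hsub : IntegrableOn
      (fun x => ‖h x‖ ^ 2 - 2 * (h x * (starRingEnd ℂ) (p x)).re) T := hh2.sub (hre.const_mul 2)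
  rw [integral_add hsub (integrableOn_T_of_continuous (by fun_prop)),
    integral_sub hh2 (hre.const_mul 2), integral_const_mul, h3, h1] at h4
  linarith

theorem l2NormSq_posPart_le (n : ℕ) (f : ℝ → ℂ) :
    l2NormSq (posPart n f) ≤
      2 * Real.pi * ∑ k ∈ Finset.range n, ‖coeff f (n + (k + 1))‖ ^ 2 := by
  have h := integral_normSq_sum_ex (Finset.range n)
    (fun k : ℕ => (wt n k : ℂ) * coeff f (n + (k + 1))) (fun k => (n : ℤ) + (k + 1))
    (fun a _ b _ h => by simpa using h)
  simp only [l2NormSq, posPart]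
  rw [h]
  have := Real.pi_pos
  refine mul_le_mul_of_nonneg_left (Finset.sum_le_sum fun k hk => ?_) (by positivity)
  rw [norm_mul]
  gcongr
  exact mul_le_of_le_one_left (norm_nonneg _) (norm_wt_le_one (Finset.mem_range.1 hk))

theorem l2NormSq_demod_le (n : ℕ) {h : ℝ → ℂ} (hh : IntegrableOn h T)
    (hh2 : IntegrableOn (fun x => ‖h x‖ ^ 2) T) :
    l2NormSq (demod n h) ≤ ∫ x in T, ‖h x‖ ^ 2 := by
  have hinj : Set.InjOn (fun k : ℕ => (k : ℤ) + 1) (Finset.range n) :=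
    fun a _ b _ h => by simpa using h
  have h1 := integral_normSq_sum_ex (Finset.range n)
    (fun k : ℕ => (wt n k : ℂ) * coeff h (k + 1)) (fun k => (k : ℤ) + 1) hinj
  refine le_trans ?_ (bessel (Finset.range n) (fun k : ℕ => (k : ℤ) + 1) hinj hh hh2)
  simp only [l2NormSq, demod]
  rw [h1]
  have := Real.pi_pos
  refine mul_le_mul_of_nonneg_left (Finset.sum_le_sum fun k hk => ?_) (by positivity)
  rw [norm_mul]
  gcongr
  exact mul_le_of_le_one_left (norm_nonneg _) (norm_wt_le_one (Finset.mem_range.1 hk))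

/-! ### Dyadic intervals and the Calderón–Zygmund family -/

/-- The length of the dyadic intervals of level `p`. -/
def len (p : ℕ) : ℝ := 2 * Real.pi / 2 ^ p

theorem len_pos (p : ℕ) : 0 < len p := by unfold len; positivity

theorem len_succ (p : ℕ) : len p = 2 * len (p + 1) := by
  rw [len, len, pow_succ]; field_simp

theorem len_zero : len 0 = 2 * Real.pi := by simp [len]

theorem len_mul_two_pow (p : ℕ) : len p * 2 ^ p = 2 * Real.pi := by
  rw [len]; field_simp

theorem len_antitone : Antitone len :=
  antitone_nat_of_succ_le fun p => by rw [len_succ p]; linarith [len_pos (p + 1)]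

/-- The left end point of a dyadic interval. -/
def left (r : ℕ × ℤ) : ℝ := -Real.pi + r.2 * len r.1

theorem dyadicInterval_eq (p : ℕ) (k : ℤ) :
    dyadicInterval p k = Set.Ico (left (p, k)) (left (p, k) + len p) := by
  rw [dyadicInterval, left, len]
  congr 1; ring

/-- The index of the dyadic interval of level `p` that contains `x`. -/
def idx (p : ℕ) (x : ℝ) : ℤ := ⌊(x + Real.pi) / len p⌋

theorem mem_dyadicInterval {p : ℕ} {k : ℤ} {x : ℝ} : x ∈ dyadicInterval p k ↔ idx p x = k := by
  have h := len_pos p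
  rw [idx, Int.floor_eq_iff, le_div_iff₀ h, div_lt_iff₀ h, dyadicInterval, Set.mem_Ico, ← len]
  constructor <;> rintro ⟨h1, h2⟩ <;> constructor <;> linarith

theorem left_mem (p : ℕ) (k : ℤ) : left (p, k) ∈ dyadicInterval p k := by
  rw [dyadicInterval_eq]; exact ⟨le_rfl, by linarith [len_pos p]⟩

theorem measurableSet_dyadicInterval (p : ℕ) (k : ℤ) : MeasurableSet (dyadicInterval p k) :=
  measurableSet_Ico

theorem volume_real_dyadicInterval (p : ℕ) (k : ℤ) :
    volume.real (dyadicInterval p k) = len p := by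
  rw [dyadicInterval_eq, Real.volume_real_Ico_of_le (by linarith [len_pos p])]; ring

theorem idx_mem {p : ℕ} {x : ℝ} (hx : x ∈ T) : (p, idx p x) ∈ dyadicIndex := by
  have h := len_pos p
  have h2 := len_mul_two_pow p
  constructor
  · exact Int.floor_nonneg.2 (div_nonneg (by linarith [hx.1]) h.le)
  · change idx p x < 2 ^ p
    rw [idx, Int.floor_lt, div_lt_iff₀ h]
    push_cast
    linarith [hx.2]

theorem idx_eq_ediv {p q : ℕ} (h : q ≤ p) (x : ℝ) : idx q x = idx p x / 2 ^ (p - q) := by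
  have h1 : (x + Real.pi) / len q = (x + Real.pi) / len p / ((2 ^ (p - q) : ℕ) : ℝ) := by
    have : len q = len p * 2 ^ (p - q) := by
      rw [len, len, ← pow_sub_mul_pow (2 : ℝ) h]; field_simp
    rw [this, div_div]; push_cast; rfl
  rw [idx, h1, Int.floor_div_natCast, idx]
  push_cast; rfl

theorem dyadicInterval_subset_T {r : ℕ × ℤ} (hr : r ∈ dyadicIndex) :
    dyadicInterval r.1 r.2 ⊆ T := by
  intro x hx
  have h := len_pos r.1
  have h2 := len_mul_two_pow r.1
  rw [dyadicInterval, ← len] at hx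
  have h3 : (0 : ℝ) ≤ r.2 := by exact_mod_cast hr.1
  have h4 : (r.2 : ℝ) + 1 ≤ 2 ^ r.1 := by exact_mod_cast hr.2
  have h5 := mul_nonneg h3 h.le
  have h6 := mul_le_mul_of_nonneg_right h4 h.le
  exact ⟨by linarith [hx.1], by linarith [hx.2]⟩

/-- Dyadic intervals that meet are nested. -/
theorem dyadicInterval_subset {r s : ℕ × ℤ} {x : ℝ} (hr : x ∈ dyadicInterval r.1 r.2)
    (hs : x ∈ dyadicInterval s.1 s.2) (h : s.1 ≤ r.1) :
    dyadicInterval r.1 r.2 ⊆ dyadicInterval s.1 s.2 := by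
  intro y hy
  rw [mem_dyadicInterval] at *
  rw [← hs, idx_eq_ediv h, idx_eq_ediv h, hr, hy]

theorem lt_of_dyadicInterval_ssubset {r s : ℕ × ℤ}
    (h : dyadicInterval r.1 r.2 ⊂ dyadicInterval s.1 s.2) : s.1 < r.1 := by
  by_contra! hle
  exact h.2 (dyadicInterval_subset (h.1 (left_mem _ _)) (left_mem _ _) hle)

theorem dyadicInterval_ssubset {r s : ℕ × ℤ} {x : ℝ} (hr : x ∈ dyadicInterval r.1 r.2)
    (hs : x ∈ dyadicInterval s.1 s.2) (h : s.1 < r.1) :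
    dyadicInterval r.1 r.2 ⊂ dyadicInterval s.1 s.2 := by
  refine ⟨dyadicInterval_subset hr hs h.le, fun hsub => ?_⟩
  have h1 := measureReal_mono (μ := volume) hsub
    (by rw [dyadicInterval_eq, Real.volume_Ico]; exact ENNReal.ofReal_ne_top)
  rw [volume_real_dyadicInterval, volume_real_dyadicInterval] at h1
  have h2 := len_antitone (Nat.succ_le_of_lt h)
  rw [len_succ s.1] at h1
  have := len_pos (s.1 + 1)
  simp only [Nat.succ_eq_add_one] at h2
  linarith

theorem eq_of_mem_dyadicInterval {r s : ℕ × ℤ} {x : ℝ} (hr : x ∈ dyadicInterval r.1 r.2)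
    (hs : x ∈ dyadicInterval s.1 s.2) (h : r.1 = s.1) : r = s := by
  rw [mem_dyadicInterval] at hr hs
  exact Prod.ext h (by rw [← hr, ← hs, h])

theorem setAverage_dyadicInterval (g : ℝ → ℝ) (r : ℕ × ℤ) :
    (⨍ x in dyadicInterval r.1 r.2, g x) = (∫ x in dyadicInterval r.1 r.2, g x) / len r.1 := by
  rw [setAverage_eq, volume_real_dyadicInterval, smul_eq_mul, inv_mul_eq_div]

/-- The dyadic intervals of level `p` cover `T`. -/
theorem iUnion_dyadicInterval (p : ℕ) :
    ⋃ k ∈ Finset.Ico (0 : ℤ) (2 ^ p), dyadicInterval p k = T := by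
  ext x
  simp only [Set.mem_iUnion, Finset.mem_Ico, exists_prop]
  constructor
  · rintro ⟨k, hk, hx⟩; exact dyadicInterval_subset_T (r := (p, k)) hk hx
  · exact fun hx => ⟨idx p x, idx_mem hx, mem_dyadicInterval.2 rfl⟩

/-! ### The stopping-time family of selected intervals -/

section

variable {f : ℝ → ℂ} {lam : ℝ}

theorem lam_nonneg (hlam : (∫ x in T, ‖f x‖) / (2 * Real.pi) < lam) : 0 ≤ lam := by
  have : 0 ≤ ∫ x in T, ‖f x‖ := integral_nonneg fun x => norm_nonneg _
  have h2 := Real.pi_pos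
  exact (div_nonneg this (by positivity)).trans hlam.le

theorem setIntegral_norm_mono (hf : IntegrableOn f T) {s t : Set ℝ} (hst : s ⊆ t) (ht : t ⊆ T) :
    ∫ x in s, ‖f x‖ ≤ ∫ x in t, ‖f x‖ :=
  setIntegral_mono_set (hf.mono_set ht).norm
    (Filter.Eventually.of_forall fun _ => norm_nonneg _) hst.eventuallyLE

theorem mem_czFamily {r : ℕ × ℤ} : r ∈ czFamily f lam ↔ r ∈ dyadicIndex ∧
    lam * len r.1 < (∫ x in dyadicInterval r.1 r.2, ‖f x‖) ∧
    ∀ s ∈ dyadicIndex, dyadicInterval r.1 r.2 ⊂ dyadicInterval s.1 s.2 →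
      (∫ x in dyadicInterval s.1 s.2, ‖f x‖) ≤ lam * len s.1 := by
  simp only [czFamily, Set.mem_ofPred_eq, setAverage_dyadicInterval, lt_div_iff₀ (len_pos _),
    div_le_iff₀ (len_pos _)]

/-- An interval with a large mean is contained in a selected interval. -/
theorem exists_mem_czFamily (r : ℕ × ℤ) (hr : r ∈ dyadicIndex)
    (h : lam * len r.1 < ∫ x in dyadicInterval r.1 r.2, ‖f x‖) :
    ∃ s ∈ czFamily f lam, s.1 ≤ r.1 ∧ dyadicInterval r.1 r.2 ⊆ dyadicInterval s.1 s.2 := by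
  by_cases hm : ∀ s ∈ dyadicIndex, dyadicInterval r.1 r.2 ⊂ dyadicInterval s.1 s.2 →
      (∫ x in dyadicInterval s.1 s.2, ‖f x‖) ≤ lam * len s.1
  · exact ⟨r, mem_czFamily.2 ⟨hr, h, hm⟩, le_rfl, subset_rfl⟩
  · push Not at hm
    obtain ⟨s, hs, hrs, hl⟩ := hm
    have hlt := lt_of_dyadicInterval_ssubset hrs
    obtain ⟨u, hu, hus, hsub⟩ := exists_mem_czFamily s hs hl
    exact ⟨u, hu, hus.trans hlt.le, hrs.1.trans hsub⟩
termination_by r.1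

/-- An interval with a mean exceeding `2 * lam` is contained in a larger selected interval. -/
theorem exists_mem_czFamily_lt (hf : IntegrableOn f T)
    (hlam : (∫ x in T, ‖f x‖) / (2 * Real.pi) < lam) {r : ℕ × ℤ} (hr : r ∈ dyadicIndex)
    (h : 2 * lam * len r.1 < ∫ x in dyadicInterval r.1 r.2, ‖f x‖) :
    ∃ s ∈ czFamily f lam, s.1 < r.1 ∧ dyadicInterval r.1 r.2 ⊆ dyadicInterval s.1 s.2 := by
  obtain ⟨p, k⟩ := r
  have hT := dyadicInterval_subset_T hr
  cases p with
  | zero =>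
    -- The mean over all of `T` is below `lam`, so the root interval cannot exceed `2 * lam`; any
    -- other interval has a parent of twice its length, whose mean exceeds `lam`.
    exfalso
    have h1 := setIntegral_norm_mono hf hT subset_rfl
    rw [div_lt_iff₀ (by positivity)] at hlam
    simp only [len_zero] at h h1
    have h2 := mul_nonneg ((setIntegral_nonneg measurableSet_T fun x _ =>
      norm_nonneg (f x)).trans hlam.le) zero_le_two
    linarith
  | succ q =>
    set s : ℕ × ℤ := (q, idx q (left (q + 1, k))) with hs
    have hx : left (q + 1, k) ∈ dyadicInterval (q + 1) k := left_mem _ _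
    have hsi : s ∈ dyadicIndex := idx_mem (hT hx)
    have hsub : dyadicInterval (q + 1) k ⊆ dyadicInterval s.1 s.2 :=
      dyadicInterval_subset (r := (q + 1, k)) hx (mem_dyadicInterval.2 rfl) (Nat.le_succ q)
    have hl : lam * len s.1 < ∫ x in dyadicInterval s.1 s.2, ‖f x‖ := by
      have h1 := setIntegral_norm_mono hf hsub (dyadicInterval_subset_T hsi)
      have h2 := len_succ q
      simp only [hs] at h h1 ⊢
      rw [h2]; linarith
    obtain ⟨u, hu, hus, hsub'⟩ := exists_mem_czFamily s hsi hl
    exact ⟨u, hu, Nat.lt_succ_of_le hus, hsub.trans hsub'⟩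

/-- A mean above `2 * lam` would produce a strictly larger selected interval and contradict
maximality. -/
theorem integral_le_of_mem_czFamily (hf : IntegrableOn f T)
    (hlam : (∫ x in T, ‖f x‖) / (2 * Real.pi) < lam) {r : ℕ × ℤ} (hr : r ∈ czFamily f lam) :
    ∫ x in dyadicInterval r.1 r.2, ‖f x‖ ≤ 2 * lam * len r.1 := by
  by_contra! h
  rw [mem_czFamily] at hr
  obtain ⟨s, hs, hsr, hsub⟩ := exists_mem_czFamily_lt hf hlam hr.1 h
  have h1 := hr.2.2 s (mem_czFamily.1 hs).1
    (dyadicInterval_ssubset (left_mem _ _) (hsub (left_mem _ _)) hsr)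
  exact h1.not_gt (mem_czFamily.1 hs).2.1

theorem disjoint_of_mem_czFamily {r s : ℕ × ℤ} (hr : r ∈ czFamily f lam)
    (hs : s ∈ czFamily f lam) (hrs : r ≠ s) :
    Disjoint (dyadicInterval r.1 r.2) (dyadicInterval s.1 s.2) := by
  refine Set.disjoint_left.2 fun x hx hx' => ?_
  rw [mem_czFamily] at hr hs
  rcases lt_trichotomy r.1 s.1 with h | h | h
  · exact (hs.2.2 r hr.1 (dyadicInterval_ssubset hx' hx h)).not_gt hr.2.1
  · exact hrs (eq_of_mem_dyadicInterval hx hx' h)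
  · exact (hr.2.2 s hs.1 (dyadicInterval_ssubset hx hx' h)).not_gt hs.2.1

theorem finite_czFamily_lt (f : ℝ → ℂ) (lam : ℝ) (p : ℕ) :
    {r | r ∈ czFamily f lam ∧ r.1 < p}.Finite := by
  refine ((Finset.range p) ×ˢ (Finset.Ico (0 : ℤ) (2 ^ p))).finite_toSet.subset ?_
  rintro r ⟨hr, hp⟩
  have h := (mem_czFamily.1 hr).1
  have h2 : (2 : ℤ) ^ r.1 ≤ 2 ^ p := pow_le_pow_right₀ (by norm_num) hp.le
  simp only [Finset.coe_product, Set.mem_prod, Finset.mem_coe, Finset.mem_range,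
    Finset.mem_Ico]
  exact ⟨hp, h.1, h.2.trans_le h2⟩

/-- The selected intervals of level less than `p`. -/
def czFinset (f : ℝ → ℂ) (lam : ℝ) (p : ℕ) : Finset (ℕ × ℤ) := (finite_czFamily_lt f lam p).toFinset

theorem mem_czFinset {p : ℕ} {r : ℕ × ℤ} :
    r ∈ czFinset f lam p ↔ r ∈ czFamily f lam ∧ r.1 < p := by
  simp [czFinset]

/-- The union of the selected intervals of level less than `p`. -/
def bigSet (f : ℝ → ℂ) (lam : ℝ) (p : ℕ) : Set ℝ :=
  ⋃ r ∈ czFinset f lam p, dyadicInterval r.1 r.2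

theorem measurableSet_bigSet (f : ℝ → ℂ) (lam : ℝ) (p : ℕ) : MeasurableSet (bigSet f lam p) :=
  Finset.measurableSet_biUnion _ fun r _ => measurableSet_dyadicInterval r.1 r.2

theorem bigSet_subset_T (f : ℝ → ℂ) (lam : ℝ) (p : ℕ) : bigSet f lam p ⊆ T :=
  Set.iUnion₂_subset fun _ hr =>
    dyadicInterval_subset_T (mem_czFamily.1 (mem_czFinset.1 hr).1).1

theorem bigSet_mono (f : ℝ → ℂ) (lam : ℝ) : Monotone (bigSet f lam) := fun _ _ h =>
  Set.biUnion_subset_biUnion_left fun _ hr =>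
    mem_czFinset.2 ⟨(mem_czFinset.1 hr).1, (mem_czFinset.1 hr).2.trans_le h⟩

theorem pairwise_disjoint_czFinset (f : ℝ → ℂ) (lam : ℝ) (p : ℕ) :
    (czFinset f lam p : Set (ℕ × ℤ)).Pairwise
      (Function.onFun Disjoint fun r => dyadicInterval r.1 r.2) := fun _ hr _ hs hrs =>
  disjoint_of_mem_czFamily (mem_czFinset.1 hr).1 (mem_czFinset.1 hs).1 hrs

/-- Outside the selected larger intervals the means at level `p` are at most `2 * lam`. -/
theorem integral_diff_bigSet_le (hf : IntegrableOn f T)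
    (hlam : (∫ x in T, ‖f x‖) / (2 * Real.pi) < lam) {p : ℕ} {k : ℤ}
    (hk : (p, k) ∈ dyadicIndex) :
    ∫ x in dyadicInterval p k \ bigSet f lam p, ‖f x‖ ≤ 2 * lam * len p := by
  by_cases h : 2 * lam * len p < ∫ x in dyadicInterval p k, ‖f x‖
  · obtain ⟨s, hs, hsp, hsub⟩ := exists_mem_czFamily_lt hf hlam hk h
    have : dyadicInterval p k \ bigSet f lam p = ∅ := by
      rw [Set.sdiff_eq_empty]
      exact hsub.trans (Set.subset_biUnion_of_mem (u := fun r : ℕ × ℤ => dyadicInterval r.1 r.2)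
        (mem_czFinset.2 ⟨hs, hsp⟩))
    rw [this, setIntegral_empty]
    have := lam_nonneg hlam
    have := len_pos p
    positivity
  · exact (setIntegral_norm_mono hf Set.sdiff_subset
      (dyadicInterval_subset_T hk)).trans (not_lt.1 h)

theorem sum_len_czFinset_le (hf : IntegrableOn f T) (p : ℕ) :
    lam * ∑ r ∈ czFinset f lam p, len r.1 ≤ ∫ x in T, ‖f x‖ := by
  have hi : ∀ r ∈ czFinset f lam p, IntegrableOn (fun x => ‖f x‖) (dyadicInterval r.1 r.2) :=
    fun r hr => (hf.mono_set
      (dyadicInterval_subset_T (mem_czFamily.1 (mem_czFinset.1 hr).1).1)).norm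
  calc lam * ∑ r ∈ czFinset f lam p, len r.1
      ≤ ∑ r ∈ czFinset f lam p, ∫ x in dyadicInterval r.1 r.2, ‖f x‖ := by
        rw [Finset.mul_sum]
        exact Finset.sum_le_sum fun r hr => (mem_czFamily.1 (mem_czFinset.1 hr).1).2.1.le
    _ = ∫ x in bigSet f lam p, ‖f x‖ :=
        (integral_biUnion_finset _ (fun r _ => measurableSet_dyadicInterval r.1 r.2)
          (pairwise_disjoint_czFinset f lam p) hi).symm
    _ ≤ ∫ x in T, ‖f x‖ := setIntegral_norm_mono hf (bigSet_subset_T f lam p) subset_rfl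

end

/-! ### Chordal distance and dilates -/

theorem rho_of_mem_dyadicInterval {p : ℕ} {k : ℤ} {x y : ℝ} (hx : x ∈ dyadicInterval p k)
    (hy : y ∈ dyadicInterval p k) : rho x y ≤ len p := by
  rw [dyadicInterval_eq] at hx hy
  refine (rho_le_abs x y).trans (abs_le.2 ⟨?_, ?_⟩) <;> linarith [hx.1, hx.2, hy.1, hy.2]

/-- Points of `T` that are close to a dyadic interval belong to its dilates. -/
theorem mem_dilate {β : ℕ} (hβ : 9 ≤ β) {r : ℕ × ℤ} {e : ℝ} (he : e ∈ T)
    (h : rho e (left r) < 5 / 2 * len r.1) : e ∈ dilate β r := by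
  obtain ⟨p, k⟩ := r
  have hl := len_pos p
  have hpi := Real.pi_pos
  have h2 := len_mul_two_pow p
  set d0 := e - left (p, k) with hd0
  -- Subtracting `m` full turns gives the representative `d` with `|d| ≤ π`, on which chord and arc
  -- are comparable; the turns shift the index by `m * 2 ^ p`, which the reduction modulo `2 ^ p` in
  -- `dilate` undoes.
  set m : ℤ := round (d0 / (2 * Real.pi)) with hm
  set d := d0 - m * (2 * Real.pi) with hd
  have hdpi : |d| ≤ Real.pi := by
    have h1 := abs_sub_round (d0 / (2 * Real.pi))
    have h3 : d = (d0 / (2 * Real.pi) - m) * (2 * Real.pi) := by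
      rw [hd]; field_simp
    rw [h3, abs_mul, abs_of_pos (by positivity : 0 < 2 * Real.pi)]
    nlinarith
  have hrho : rho e (left (p, k)) = rho d 0 := by
    have h3 : cis (m * (2 * Real.pi)) = 1 := by
      have := Complex.exp_int_mul_two_pi_mul_I m
      rw [cis, ← this]; push_cast; ring_nf
    have h4 : d0 = d + m * (2 * Real.pi) := by rw [hd]; ring
    rw [rho_eq_norm_one_sub, rho_eq_norm_one_sub, sub_zero, ← hd0, h4, cis_add, h3, mul_one]
  -- Jordan's inequality costs a factor `π/2`, and `(5/2)(π/2) < 4`. As `e` lies up to one length to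
  -- the right of the left end of its cell, the index offset ranges over `-4, …, 3`, which is why
  -- `(β - 1)/2 ≥ 4` is needed.
  have hd4 : |d| < 4 * len p := by
    have h1 := le_rho (x := d) (y := 0) (by rwa [sub_zero])
    rw [sub_zero, ← hrho] at h1
    have h3 := h1.trans_lt h
    rw [div_mul_eq_mul_div, div_lt_iff₀ hpi] at h3
    simp only at h3
    nlinarith [Real.pi_lt_d2]
  have hfl := mem_dyadicInterval.2 (rfl : idx p e = idx p e)
  set k' := idx p e with hk'
  rw [dyadicInterval_eq, left] at hfl
  simp only [left] at hd0
  obtain ⟨hd4l, hd4r⟩ := abs_lt.1 hd4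
  have e1 : ((k' - k - m * 2 ^ p : ℤ) : ℝ) * len p =
      k' * len p - k * len p - m * (2 * Real.pi) := by
    push_cast; rw [← h2]; ring
  have hi1 : k' - k - m * 2 ^ p < 4 := by
    have : ((k' - k - m * 2 ^ p : ℤ) : ℝ) < (4 : ℤ) := by
      refine lt_of_mul_lt_mul_right ?_ hl.le
      rw [e1]; push_cast; linarith [hfl.1]
    exact_mod_cast this
  have hi2 : -5 < k' - k - m * 2 ^ p := by
    have : ((-5 : ℤ) : ℝ) < ((k' - k - m * 2 ^ p : ℤ) : ℝ) := by
      refine lt_of_mul_lt_mul_right ?_ hl.le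
      rw [e1]; push_cast; linarith [hfl.2]
    exact_mod_cast this
  have hβ4 : 4 ≤ (β - 1) / 2 := by omega
  refine Set.mem_iUnion₂.2 ⟨k' - k - m * 2 ^ p, ⟨?_, ?_⟩, ?_⟩
  · have : ((4 : ℕ) : ℤ) ≤ ((β - 1) / 2 : ℕ) := by exact_mod_cast hβ4
    push_cast at this ⊢; linarith
  · have : ((4 : ℕ) : ℤ) ≤ ((β - 1) / 2 : ℕ) := by exact_mod_cast hβ4
    push_cast at this ⊢; linarith
  · have hidx := idx_mem (p := p) he
    rw [mem_dyadicInterval]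
    have e2 : k + (k' - k - m * 2 ^ p) = k' + 2 ^ p * (-m) := by ring
    simp only [e2]
    rw [Int.add_mul_emod_self_left, Int.emod_eq_of_lt hidx.1 hidx.2]

theorem measurableSet_dilatedSet (f : ℝ → ℂ) (lam : ℝ) (β : ℕ) (ε : ℝ) :
    MeasurableSet (dilatedSet f lam β ε) :=
  MeasurableSet.biUnion (Set.to_countable _) fun _ _ =>
    MeasurableSet.biUnion (Set.to_countable _) fun _ _ => measurableSet_Ico

/-! ### The contribution of the complement of the large selected intervals -/

theorem len_mul_phi_le {a : ℝ} {p : ℕ} (hp : len p ≤ a) {k : ℤ} {x : ℝ}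
    (hx : x ∈ dyadicInterval p k) (hk : (p, k) ∈ dyadicIndex) (u : ℝ) :
    len p * phi a x u ≤ 3 * ∫ y in dyadicInterval p k, phi a y u := by
  have ha := (len_pos p).trans_le hp
  have hi : IntegrableOn (fun y => phi a y u) (dyadicInterval p k) :=
    (integrableOn_T_of_continuous (continuous_phi_left ha u)).mono_set
      (dyadicInterval_subset_T hk)
  have hfin : volume (dyadicInterval p k) ≠ ⊤ :=
    ((measure_mono (dyadicInterval_subset_T hk)).trans_lt volume_T_lt_top).ne
  have h1 : ∫ _ in dyadicInterval p k, phi a x u ≤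
      ∫ y in dyadicInterval p k, 3 * phi a y u :=
    setIntegral_mono_on (integrableOn_const hfin) (hi.const_mul 3)
      (measurableSet_dyadicInterval p k) fun y hy =>
        phi_le_three_mul ha ((rho_of_mem_dyadicInterval hx hy).trans hp) u
  rwa [setIntegral_const, volume_real_dyadicInterval, smul_eq_mul, integral_const_mul] at h1

theorem sum_integral_dyadicInterval_phi {a : ℝ} (ha : 0 < a) (p : ℕ) (u : ℝ) :
    ∑ k ∈ Finset.Ico (0 : ℤ) (2 ^ p), ∫ y in dyadicInterval p k, phi a y u =
      ∫ y in T, phi a y u := by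
  rw [← iUnion_dyadicInterval p, integral_biUnion_finset _
    (fun k _ => measurableSet_dyadicInterval p k)]
  · intro k _ l _ hkl
    refine Set.disjoint_left.2 fun x hx hx' => hkl ?_
    rw [mem_dyadicInterval] at hx hx'
    rw [← hx, ← hx']
  · exact fun k hk => (integrableOn_T_of_continuous (continuous_phi_left ha u)).mono_set
      (dyadicInterval_subset_T (r := (p, k)) (Finset.mem_Ico.1 hk))

section

variable {f : ℝ → ℂ} {lam : ℝ}

theorem integrableOn_norm_mul_phi {s : Set ℝ} (hf : IntegrableOn f s) {a : ℝ} (ha : 0 < a)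
    (u : ℝ) : IntegrableOn (fun y => ‖f y‖ * phi a y u) s :=
  hf.norm.mul_bdd (c := 1) (continuous_phi_left ha u).aestronglyMeasurable
    (Filter.Eventually.of_forall fun x => by
      rw [Real.norm_of_nonneg (phi_nonneg _ _ _)]; exact phi_le_one ha x u)

/-- Off the larger selected intervals, `|f|` looks bounded by `2 * lam` at scale `len p`. The bump
is nearly constant on cells of that length, so on each cell the mass of `|f|` may be traded for `2 *
lam * len p`. The constant is `2 · 3 · 3 · 5`: two comparisons of the bump and its integral. -/
theorem integral_norm_mul_phi_le (hf : IntegrableOn f T)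
    (hlam : (∫ x in T, ‖f x‖) / (2 * Real.pi) < lam) (p : ℕ) (u : ℝ) :
    ∫ y in T \ bigSet f lam p, ‖f y‖ * phi (len p) y u ≤ 90 * lam * len p := by
  have hl := len_pos p
  have hl0 := lam_nonneg hlam
  have hQ := measurableSet_bigSet f lam p
  have hset : T \ bigSet f lam p =
      ⋃ k ∈ Finset.Ico (0 : ℤ) (2 ^ p), dyadicInterval p k \ bigSet f lam p := by
    rw [← iUnion_dyadicInterval p]
    simp only [Set.iUnion_sdiff]
  have hsub : ∀ k ∈ Finset.Ico (0 : ℤ) (2 ^ p), dyadicInterval p k \ bigSet f lam p ⊆ T :=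
    fun k hk => Set.sdiff_subset.trans
      (dyadicInterval_subset_T (r := (p, k)) (Finset.mem_Ico.1 hk))
  calc ∫ y in T \ bigSet f lam p, ‖f y‖ * phi (len p) y u
      = ∑ k ∈ Finset.Ico (0 : ℤ) (2 ^ p),
          ∫ y in dyadicInterval p k \ bigSet f lam p, ‖f y‖ * phi (len p) y u := by
        rw [hset, integral_biUnion_finset _
          (fun k _ => (measurableSet_dyadicInterval p k).diff hQ)]
        · intro k _ l _ hkl
          refine Set.disjoint_left.2 fun x hx hx' => hkl ?_
          rw [← mem_dyadicInterval.1 hx.1, ← mem_dyadicInterval.1 hx'.1]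
        · exact fun k hk => integrableOn_norm_mul_phi (hf.mono_set (hsub k hk)) hl u
    _ ≤ ∑ k ∈ Finset.Ico (0 : ℤ) (2 ^ p),
          18 * lam * ∫ y in dyadicInterval p k, phi (len p) y u := by
        refine Finset.sum_le_sum fun k hk => ?_
        have hk' : (p, k) ∈ dyadicIndex := Finset.mem_Ico.1 hk
        have hx := left_mem p k
        have hphi := phi_nonneg (len p) (left (p, k)) u
        calc ∫ y in dyadicInterval p k \ bigSet f lam p, ‖f y‖ * phi (len p) y u
            ≤ ∫ y in dyadicInterval p k \ bigSet f lam p,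
                ‖f y‖ * (3 * phi (len p) (left (p, k)) u) := by
              refine setIntegral_mono_on
                (integrableOn_norm_mul_phi (hf.mono_set (hsub k hk)) hl u)
                ((hf.mono_set (hsub k hk)).norm.mul_const _)
                ((measurableSet_dyadicInterval p k).diff hQ) fun y hy => ?_
              gcongr
              exact phi_le_three_mul hl (rho_of_mem_dyadicInterval hy.1 hx) u
          _ = (∫ y in dyadicInterval p k \ bigSet f lam p, ‖f y‖) *
                (3 * phi (len p) (left (p, k)) u) := integral_mul_const _ _
          _ ≤ 2 * lam * len p * (3 * phi (len p) (left (p, k)) u) := by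
              gcongr
              exact integral_diff_bigSet_le hf hlam hk'
          _ = 6 * lam * (len p * phi (len p) (left (p, k)) u) := by ring
          _ ≤ 6 * lam * (3 * ∫ y in dyadicInterval p k, phi (len p) y u) := by
              exact mul_le_mul_of_nonneg_left (len_mul_phi_le le_rfl hx hk' u) (by positivity)
          _ = 18 * lam * ∫ y in dyadicInterval p k, phi (len p) y u := by ring
    _ = 18 * lam * ∫ y in T, phi (len p) y u := by
        rw [← Finset.mul_sum, sum_integral_dyadicInterval_phi hl]
    _ ≤ 18 * lam * (5 * len p) := by
        gcongr
        exact integral_phi_le hl u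
    _ = 90 * lam * len p := by ring

/-! ### Energy estimates by removing levels -/

/-- The integrand of the energy of `|f|`. -/
def energy (f : ℝ → ℂ) (b : ℝ) (z : ℝ × ℝ) : ENNReal :=
  ‖f z.1‖ₑ * (‖f z.2‖ₑ * ENNReal.ofReal (phi b z.2 z.1))

theorem energy_swap (f : ℝ → ℂ) (b x y : ℝ) : energy f b (x, y) = energy f b (y, x) := by
  simp only [energy, phi_comm b y x]; ring

theorem aemeasurable_energy {s t : Set ℝ} (hs : IntegrableOn f s) (ht : IntegrableOn f t)
    {b : ℝ} (hb : 0 < b) :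
    AEMeasurable (energy f b) ((volume.restrict s).prod (volume.restrict t)) := by
  have h1 := hs.aestronglyMeasurable.enorm.comp_quasiMeasurePreserving
    (Measure.quasiMeasurePreserving_fst (ν := volume.restrict t))
  have h2 := ht.aestronglyMeasurable.enorm.comp_quasiMeasurePreserving
    (Measure.quasiMeasurePreserving_snd (μ := volume.restrict s))
  refine h1.mul (h2.mul (Measurable.aemeasurable ?_))
  exact ENNReal.measurable_ofReal.comp
    ((continuous_phi hb).comp (continuous_snd.prodMk continuous_fst)).measurable

theorem lintegral_energy_prod {s t : Set ℝ} (hs : IntegrableOn f s) (ht : IntegrableOn f t)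
    {b : ℝ} (hb : 0 < b) :
    ∫⁻ z in s ×ˢ t, energy f b z = ∫⁻ x in s, ∫⁻ y in t, energy f b (x, y) := by
  rw [Measure.volume_eq_prod, ← Measure.prod_restrict,
    lintegral_prod _ (aemeasurable_energy hs ht hb)]

theorem lintegral_energy_prod_comm {s t : Set ℝ} (hs : IntegrableOn f s) (ht : IntegrableOn f t)
    {b : ℝ} (hb : 0 < b) :
    ∫⁻ z in s ×ˢ t, energy f b z = ∫⁻ z in t ×ˢ s, energy f b z := by
  rw [lintegral_energy_prod ht hs hb, Measure.volume_eq_prod, ← Measure.prod_restrict,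
    lintegral_prod_symm _ (aemeasurable_energy hs ht hb)]
  simp only [energy_swap f b]

/-- The inner integral is bounded uniformly in `x` after widening the bump from `b` to `len p`.
Working in `ENNReal` avoids any prior claim that the double integral is finite. -/
theorem lintegral_energy_le (hf : IntegrableOn f T)
    (hlam : (∫ x in T, ‖f x‖) / (2 * Real.pi) < lam) {p : ℕ} {b : ℝ} (hb : 0 < b)
    (hbp : b ≤ len p) {D : Set ℝ} (hD : D ⊆ T) :
    ∫⁻ z in D ×ˢ (T \ bigSet f lam p), energy f b z ≤
      ENNReal.ofReal (90 * lam * len p * ∫ x in D, ‖f x‖) := by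
  have hl := len_pos p
  have hl0 := lam_nonneg hlam
  have hfS : IntegrableOn f (T \ bigSet f lam p) := hf.mono_set Set.sdiff_subset
  rw [lintegral_energy_prod (hf.mono_set hD) hfS hb]
  have hin : ∀ x, ∫⁻ y in T \ bigSet f lam p, ‖f y‖ₑ * ENNReal.ofReal (phi b y x) ≤
      ENNReal.ofReal (90 * lam * len p) := fun x => by
    calc ∫⁻ y in T \ bigSet f lam p, ‖f y‖ₑ * ENNReal.ofReal (phi b y x)
        ≤ ∫⁻ y in T \ bigSet f lam p, ENNReal.ofReal (‖f y‖ * phi (len p) y x) := by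
          refine lintegral_mono fun y => ?_
          rw [← ofReal_norm, ← ENNReal.ofReal_mul (norm_nonneg _)]
          exact ENNReal.ofReal_le_ofReal
            (mul_le_mul_of_nonneg_left (phi_mono hb hbp y x) (norm_nonneg _))
      _ = ENNReal.ofReal (∫ y in T \ bigSet f lam p, ‖f y‖ * phi (len p) y x) :=
          (ofReal_integral_eq_lintegral_ofReal (integrableOn_norm_mul_phi hfS hl x)
            (Filter.Eventually.of_forall fun y =>
              mul_nonneg (norm_nonneg _) (phi_nonneg _ _ _))).symm
      _ ≤ _ := ENNReal.ofReal_le_ofReal (integral_norm_mul_phi_le hf hlam p x)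
  calc ∫⁻ x in D, ∫⁻ y in T \ bigSet f lam p, energy f b (x, y)
      ≤ ∫⁻ x in D, ‖f x‖ₑ * ENNReal.ofReal (90 * lam * len p) := by
        refine lintegral_mono fun x => ?_
        simp only [energy]
        rw [lintegral_const_mul' _ _ enorm_ne_top]
        gcongr
        exact hin x
    _ = ENNReal.ofReal (90 * lam * len p * ∫ x in D, ‖f x‖) := by
        rw [lintegral_mul_const' _ _ ENNReal.ofReal_ne_top, mul_comm,
          ENNReal.ofReal_mul (p := 90 * lam * len p) (by positivity),
          ofReal_integral_norm_eq_lintegral_enorm (hf.mono_set hD)]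

/-- The mass of `|f|` on the selected intervals of level `p`. -/
def levelMass (f : ℝ → ℂ) (lam : ℝ) (p : ℕ) : ℝ :=
  ∫ x in bigSet f lam (p + 1) \ bigSet f lam p, ‖f x‖

theorem levelMass_nonneg (f : ℝ → ℂ) (lam : ℝ) (p : ℕ) : 0 ≤ levelMass f lam p :=
  integral_nonneg fun _ => norm_nonneg _

theorem sum_levelMass_le (hf : IntegrableOn f T) (p : ℕ) :
    ∑ q ∈ Finset.range p, levelMass f lam q ≤ ∫ x in T, ‖f x‖ := by
  have h : ∑ q ∈ Finset.range p, levelMass f lam q ≤ ∫ x in bigSet f lam p, ‖f x‖ := by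
    induction p with
    | zero => simpa using integral_nonneg fun x => norm_nonneg (f x)
    | succ p ih =>
      rw [Finset.sum_range_succ, levelMass, setIntegral_sdiff (measurableSet_bigSet f lam p)
        (hf.mono_set (bigSet_subset_T f lam (p + 1))).norm
        (bigSet_mono f lam (Nat.le_succ p))]
      linarith
  exact h.trans (setIntegral_norm_mono hf (bigSet_subset_T f lam p) subset_rfl)

/-- A pair of points either has a member in the selected intervals of level exactly `p`, or avoids
them altogether. The first kind is paid for by `lintegral_energy_le` in both orders. -/
theorem lintegral_energy_step (hf : IntegrableOn f T)
    (hlam : (∫ x in T, ‖f x‖) / (2 * Real.pi) < lam) {p : ℕ} {b : ℝ} (hb : 0 < b)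
    (hbp : b ≤ len p) :
    ∫⁻ z in (T \ bigSet f lam p) ×ˢ (T \ bigSet f lam p), energy f b z ≤
      ENNReal.ofReal (180 * lam * (len p * levelMass f lam p)) +
        ∫⁻ z in (T \ bigSet f lam (p + 1)) ×ˢ (T \ bigSet f lam (p + 1)), energy f b z := by
  set S := T \ bigSet f lam p
  set S' := T \ bigSet f lam (p + 1)
  set D := bigSet f lam (p + 1) \ bigSet f lam p
  have hl := len_pos p
  have hl0 := lam_nonneg hlam
  have hDT : D ⊆ T := Set.sdiff_subset.trans (bigSet_subset_T f lam (p + 1))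
  have hDS := lintegral_energy_le hf hlam hb hbp hDT
  have hSD : ∫⁻ z in S ×ˢ D, energy f b z ≤
      ENNReal.ofReal (90 * lam * len p * ∫ x in D, ‖f x‖) := by
    rw [lintegral_energy_prod_comm (hf.mono_set Set.sdiff_subset) (hf.mono_set hDT) hb]
    exact hDS
  have hsub : S ×ˢ S ⊆ (D ×ˢ S ∪ S ×ˢ D) ∪ S' ×ˢ S' := by
    rintro ⟨x, y⟩ ⟨hx, hy⟩
    by_cases hxD : x ∈ bigSet f lam (p + 1)
    · exact Or.inl (Or.inl ⟨⟨hxD, hx.2⟩, hy⟩)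
    · by_cases hyD : y ∈ bigSet f lam (p + 1)
      · exact Or.inl (Or.inr ⟨hx, ⟨hyD, hy.2⟩⟩)
      · exact Or.inr ⟨⟨hx.1, hxD⟩, ⟨hy.1, hyD⟩⟩
  refine (lintegral_mono_set hsub).trans ((lintegral_union_le _ _ _).trans ?_)
  gcongr
  refine (lintegral_union_le _ _ _).trans ((add_le_add hDS hSD).trans ?_)
  have hm := levelMass_nonneg f lam p
  change ENNReal.ofReal (90 * lam * len p * levelMass f lam p) +
    ENNReal.ofReal (90 * lam * len p * levelMass f lam p) ≤ _
  rw [← ENNReal.ofReal_add (by positivity) (by positivity)]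
  exact ENNReal.ofReal_le_ofReal (by linarith)

/-- Removal stops at level `q`, below which the cell length may drop under the width `b`; there the
whole remaining mass is charged at once. If `p` is already beyond `q`, only this last charge is
present. -/
theorem lintegral_energy_compl_le (hf : IntegrableOn f T)
    (hlam : (∫ x in T, ‖f x‖) / (2 * Real.pi) < lam) {q : ℕ} {b : ℝ} (hb : 0 < b)
    (hbq : b ≤ len q) (p : ℕ) :
    ∫⁻ z in (T \ bigSet f lam p) ×ˢ (T \ bigSet f lam p), energy f b z ≤
      ENNReal.ofReal (180 * lam * ∑ i ∈ Finset.Ico p q, len i * levelMass f lam i +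
        90 * lam * len q * ∫ x in T, ‖f x‖) := by
  have hl0 := lam_nonneg hlam
  have hfn : 0 ≤ ∫ x in T, ‖f x‖ := integral_nonneg fun _ => norm_nonneg _
  have hlast : ∫⁻ z in (T \ bigSet f lam q) ×ˢ (T \ bigSet f lam q), energy f b z ≤
      ENNReal.ofReal (90 * lam * len q * ∫ x in T, ‖f x‖) :=
    (lintegral_mono_set (Set.prod_mono_left Set.sdiff_subset)).trans
      (lintegral_energy_le hf hlam hb hbq subset_rfl)
  have hlq := len_pos q
  rcases le_or_gt p q with hpq | hpq
  · have key : ∀ r, p ≤ r → r ≤ q →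
        ∫⁻ z in (T \ bigSet f lam p) ×ˢ (T \ bigSet f lam p), energy f b z ≤
          ENNReal.ofReal (180 * lam * ∑ i ∈ Finset.Ico p r, len i * levelMass f lam i) +
            ∫⁻ z in (T \ bigSet f lam r) ×ˢ (T \ bigSet f lam r), energy f b z := by
      intro r hpr
      induction r, hpr using Nat.le_induction with
      | base => simp
      | succ r hpr ih =>
        intro hrq
        refine (ih (by omega)).trans ?_
        have hs := lintegral_energy_step hf hlam (p := r) hb
          (hbq.trans (len_antitone (by omega)))
        have h0 : 0 ≤ ∑ i ∈ Finset.Ico p r, len i * levelMass f lam i :=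
          Finset.sum_nonneg fun i _ => mul_nonneg (len_pos i).le (levelMass_nonneg f lam i)
        have h1 : 0 ≤ len r * levelMass f lam r :=
          mul_nonneg (len_pos r).le (levelMass_nonneg f lam r)
        rw [Finset.sum_Ico_succ_top hpr, mul_add, ENNReal.ofReal_add (by positivity)
          (by positivity), add_assoc]
        gcongr
    refine (key q hpq le_rfl).trans ?_
    have h0 : 0 ≤ ∑ i ∈ Finset.Ico p q, len i * levelMass f lam i :=
      Finset.sum_nonneg fun i _ => mul_nonneg (len_pos i).le (levelMass_nonneg f lam i)
    rw [ENNReal.ofReal_add (by positivity) (by positivity)]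
    gcongr
  · rw [Finset.Ico_eq_empty (by omega), Finset.sum_empty, mul_zero, zero_add]
    refine (lintegral_mono_set ?_).trans hlast
    have := Set.sdiff_subset_sdiff_right (s := T) (bigSet_mono f lam hpq.le)
    exact Set.prod_mono this this

/-! ### Positive definiteness of the Fejér kernel -/

/-- Expanding each squared coefficient as a double integral and summing over `l, l'` assembles the
kernel `M * fejer M`, which is then bounded by a bump of width `1 / M`. This replaces the square
integrability that `f` lacks. -/
theorem sum_normSq_le_energy {S : Set ℝ} (hg : IntegrableOn f S) {M : ℕ} (hM : 1 ≤ M) :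
    ENNReal.ofReal (∑ l ∈ Finset.range M, ∑ l' ∈ Finset.range M,
      ‖∫ x in S, f x * ex (-((l' : ℤ) - l)) x‖ ^ 2) ≤
        ENNReal.ofReal (8 * M ^ 2) * ∫⁻ z in S ×ˢ S, energy f (1 / M) z := by
  have hM0 : (0 : ℝ) < M := by exact_mod_cast hM
  have hgc : IntegrableOn (fun x => (starRingEnd ℂ) (f x)) S :=
    hg.congr' (Complex.continuous_conj.comp_aestronglyMeasurable hg.aestronglyMeasurable)
      (Filter.Eventually.of_forall fun x => (Complex.norm_conj _).symm)
  set μ := (volume.restrict S).prod (volume.restrict S) with hμ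
  have hint : ∀ k : ℤ, Integrable
      (fun z : ℝ × ℝ => f z.1 * ex (-k) z.1 * ((starRingEnd ℂ) (f z.2) * ex k z.2)) μ :=
    fun k => (integrableOn_mul_ex hg (-k)).mul_prod (integrableOn_mul_ex hgc k)
  have hk : ∀ k : ℤ, ((‖∫ x in S, f x * ex (-k) x‖ ^ 2 : ℝ) : ℂ) =
      ∫ z, f z.1 * ex (-k) z.1 * ((starRingEnd ℂ) (f z.2) * ex k z.2) ∂μ := fun k => by
    rw [integral_prod_mul (fun x => f x * ex (-k) x) (fun x => (starRingEnd ℂ) (f x) * ex k x),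
      Complex.ofReal_pow, ← Complex.mul_conj', ← integral_conj]
    simp only [map_mul, conj_ex, neg_neg]
  have hsum : ((∑ l ∈ Finset.range M, ∑ l' ∈ Finset.range M,
      ‖∫ x in S, f x * ex (-((l' : ℤ) - l)) x‖ ^ 2 : ℝ) : ℂ) =
      ∫ z, f z.1 * (starRingEnd ℂ) (f z.2) * ((M * fejer M (z.2 - z.1) : ℝ) : ℂ) ∂μ := by
    have h1 : ∀ z : ℝ × ℝ,
        f z.1 * (starRingEnd ℂ) (f z.2) * ((M * fejer M (z.2 - z.1) : ℝ) : ℂ) =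
        ∑ l ∈ Finset.range M, ∑ l' ∈ Finset.range M, f z.1 * ex (-((l' : ℤ) - l)) z.1 *
          ((starRingEnd ℂ) (f z.2) * ex ((l' : ℤ) - l) z.2) := fun z => by
      rw [fejer, mul_div_cancel₀ _ hM0.ne', norm_sum_ex_sq, Finset.mul_sum]
      refine Finset.sum_congr rfl fun l _ => ?_
      rw [Finset.mul_sum]
      refine Finset.sum_congr rfl fun l' _ => ?_
      rw [ex_sub_apply]; ring
    simp only [h1]
    rw [integral_finsetSum _ fun l _ => integrable_finsetSum _ fun l' _ => hint _]
    push_cast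
    refine Finset.sum_congr rfl fun l _ => ?_
    rw [integral_finsetSum _ fun l' _ => hint _]
    refine Finset.sum_congr rfl fun l' _ => ?_
    have := hk ((l' : ℤ) - l)
    push_cast at this
    exact this
  have hnn : 0 ≤ ∑ l ∈ Finset.range M, ∑ l' ∈ Finset.range M,
      ‖∫ x in S, f x * ex (-((l' : ℤ) - l)) x‖ ^ 2 :=
    Finset.sum_nonneg fun _ _ => Finset.sum_nonneg fun _ _ => by positivity
  rw [← Real.norm_of_nonneg hnn, ← Complex.norm_real, hsum, ofReal_norm]
  refine (enorm_integral_le_lintegral_enorm _).trans ?_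
  rw [hμ, Measure.prod_restrict, ← Measure.volume_eq_prod,
    ← lintegral_const_mul' _ _ ENNReal.ofReal_ne_top]
  refine lintegral_mono fun z => ?_
  have h2 : M * fejer M (z.2 - z.1) ≤ 8 * M ^ 2 * phi (1 / M) z.2 z.1 := by
    have := mul_le_mul_of_nonneg_left (fejer_le_phi hM z.1 z.2) hM0.le
    rw [phi_comm] at this
    nlinarith
  have h3 : ‖((M * fejer M (z.2 - z.1) : ℝ) : ℂ)‖ₑ ≤
      ENNReal.ofReal (8 * M ^ 2) * ENNReal.ofReal (phi (1 / M) z.2 z.1) := by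
    rw [← ofReal_norm, Complex.norm_real,
      Real.norm_of_nonneg (mul_nonneg hM0.le (fejer_nonneg _ _)),
      ← ENNReal.ofReal_mul (by positivity)]
    exact ENNReal.ofReal_le_ofReal h2
  have h4 : ‖(starRingEnd ℂ) (f z.2)‖ₑ = ‖f z.2‖ₑ := by
    rw [← ofReal_norm, Complex.norm_conj, ofReal_norm]
  calc ‖f z.1 * (starRingEnd ℂ) (f z.2) * ((M * fejer M (z.2 - z.1) : ℝ) : ℂ)‖ₑ
      ≤ ‖f z.1‖ₑ * ‖f z.2‖ₑ *
        (ENNReal.ofReal (8 * M ^ 2) * ENNReal.ofReal (phi (1 / M) z.2 z.1)) := by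
        rw [enorm_mul, enorm_mul, h4]
        gcongr
    _ = _ := by rw [energy]; ring

theorem coeff_indicator {S : Set ℝ} (hS : MeasurableSet S) (hST : S ⊆ T) (g : ℝ → ℂ) (k : ℤ) :
    coeff (S.indicator g) k = 1 / (2 * Real.pi) * ∫ x in S, g x * ex (-k) x := by
  rw [coeff_eq]
  congr 1
  have : ∀ x, S.indicator g x * ex (-k) x = S.indicator (fun x => g x * ex (-k) x) x :=
    fun x => by by_cases hx : x ∈ S <;> simp [hx]
  simp only [this]
  rw [setIntegral_indicator hS, Set.inter_eq_right.2 hST]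

theorem norm_one_div_two_pi : ‖(1 / (2 * Real.pi) : ℂ)‖ = 1 / (2 * Real.pi) := by
  simp [abs_of_pos Real.pi_pos]

theorem l2NormSq_posPart_indicator_le {S : Set ℝ} (hS : MeasurableSet S) (hST : S ⊆ T)
    (hg : IntegrableOn f S) {n : ℕ} (hn : 1 ≤ n) {B : ℝ} (hB : 0 ≤ B)
    (hE : ∫⁻ z in S ×ˢ S, energy f (1 / (4 * n : ℕ)) z ≤ ENNReal.ofReal B) :
    l2NormSq (posPart n (S.indicator f)) ≤ 64 * n * B := by
  have hn0 : (0 : ℝ) < n := by exact_mod_cast hn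
  set u : ℤ → ℝ := fun k => ‖∫ x in S, f x * ex (-k) x‖ ^ 2 with hu
  have hu0 : ∀ k, 0 ≤ u k := fun k => by positivity
  have h1 : ∑ l ∈ Finset.range (4 * n), ∑ l' ∈ Finset.range (4 * n), u ((l' : ℤ) - l) ≤
      8 * ((4 * n : ℕ) : ℝ) ^ 2 * B := by
    have h := (sum_normSq_le_energy hg (by omega : 1 ≤ 4 * n)).trans (mul_le_mul_right hE _)
    rw [← ENNReal.ofReal_mul (by positivity)] at h
    exact (ENNReal.ofReal_le_ofReal_iff (by positivity)).1 h
  -- Each frequency in `(n, 2n]` is a difference `l' - l` with `l, l' < 4n` in at least `2n` ways,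
  -- one for every `l < 2n`. This gain of order `n` against the factor `M²` leaves the linear factor
  -- `64 n`.
  have h2 : (2 * n : ℕ) * ∑ k ∈ Finset.range n, u (n + (k + 1)) ≤
      ∑ l ∈ Finset.range (4 * n), ∑ l' ∈ Finset.range (4 * n), u ((l' : ℤ) - l) := by
    calc (2 * n : ℕ) * ∑ k ∈ Finset.range n, u (n + (k + 1))
        = ∑ l ∈ Finset.range (2 * n), ∑ k ∈ Finset.range n, u (n + (k + 1)) := by
          rw [Finset.sum_const, Finset.card_range, nsmul_eq_mul]
      _ ≤ ∑ l ∈ Finset.range (2 * n), ∑ l' ∈ Finset.range (4 * n), u ((l' : ℤ) - l) := by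
          refine Finset.sum_le_sum fun l hl => ?_
          have hl' := Finset.mem_range.1 hl
          have hinj : Set.InjOn (fun k => l + n + (k + 1)) (Finset.range n) :=
            fun a _ b _ h => by simpa using h
          have : ∑ k ∈ Finset.range n, u (n + (k + 1)) =
              ∑ l' ∈ (Finset.range n).image (fun k => l + n + (k + 1)), u ((l' : ℤ) - l) := by
            rw [Finset.sum_image hinj]
            refine Finset.sum_congr rfl fun k _ => ?_
            congr 1; push_cast; ring
          rw [this]
          refine Finset.sum_le_sum_of_subset_of_nonneg ?_ fun _ _ _ => hu0 _
          intro l' hl''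
          obtain ⟨k, hk, rfl⟩ := Finset.mem_image.1 hl''
          have := Finset.mem_range.1 hk
          exact Finset.mem_range.2 (by omega)
      _ ≤ _ := Finset.sum_le_sum_of_subset_of_nonneg
          (Finset.range_subset_range.2 (by omega)) fun _ _ _ => Finset.sum_nonneg fun _ _ => hu0 _
  have h3 : ∑ k ∈ Finset.range n, u (n + (k + 1)) ≤ 64 * n * B := by
    have h := h2.trans h1
    push_cast at h
    have : 2 * (n : ℝ) * ∑ k ∈ Finset.range n, u (n + (k + 1)) ≤ 2 * n * (64 * n * B) := by
      linarith
    exact le_of_mul_le_mul_left this (by positivity)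
  refine (l2NormSq_posPart_le n _).trans (le_trans ?_ h3)
  have hpi := Real.pi_gt_three
  rw [Finset.mul_sum]
  refine Finset.sum_le_sum fun k _ => ?_
  rw [coeff_indicator hS hST, norm_mul, norm_one_div_two_pi, mul_pow, ← mul_assoc]
  refine mul_le_of_le_one_left (hu0 _) ?_
  rw [div_pow, one_pow, mul_one_div, sq, div_mul_cancel_left₀ (by positivity)]
  exact inv_le_one_of_one_le₀ (by linarith)

theorem l2NormSq_posPart_compl_le (hf : IntegrableOn f T)
    (hlam : (∫ x in T, ‖f x‖) / (2 * Real.pi) < lam) {g : ℝ → ℂ} (hg : IntegrableOn g T)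
    (hgf : ∀ x, ‖g x‖ = ‖f x‖) {n : ℕ} (hn : 1 ≤ n) (p : ℕ) :
    l2NormSq (posPart n ((T \ bigSet f lam p).indicator g)) ≤
      20000 * lam * ((∫ x in T, ‖f x‖) +
        ∑ i ∈ Finset.Ico p (Nat.log 2 (4 * n)), n * len i * levelMass f lam i) := by
  have hn0 : (0 : ℝ) < n := by exact_mod_cast hn
  have hl0 := lam_nonneg hlam
  have hpi := Real.pi_gt_three
  have hpi2 := Real.pi_lt_d4
  have hfn : 0 ≤ ∫ x in T, ‖f x‖ := integral_nonneg fun _ => norm_nonneg _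
  -- The level at which the cell length is comparable to the kernel width `1/(4n)`: it is not
  -- smaller than this width, yet `n * len q ≤ π`, so the final charge is `O(lam * ‖f‖₁)`.
  set q := Nat.log 2 (4 * n) with hq
  have hq1 : (2 : ℝ) ^ q ≤ 4 * n := by
    exact_mod_cast Nat.pow_log_le_self 2 (by omega : 4 * n ≠ 0)
  have hq2 : 4 * (n : ℝ) ≤ 2 * 2 ^ q := by
    have : 4 * n ≤ 2 * 2 ^ q := by
      rw [mul_comm 2, ← pow_succ]
      exact (Nat.lt_pow_succ_log_self one_lt_two (4 * n)).le
    exact_mod_cast this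
  have hb : (0 : ℝ) < 1 / (4 * n : ℕ) := by push_cast; positivity
  have hbq : 1 / ((4 * n : ℕ) : ℝ) ≤ len q := by
    rw [len]; push_cast
    rw [div_le_div_iff₀ (by positivity) (by positivity)]
    nlinarith
  have hlq : n * len q ≤ Real.pi := by
    rw [len, mul_div_assoc', div_le_iff₀ (by positivity)]
    nlinarith
  have hen : energy g = energy f := by
    ext b z
    simp only [energy, ← ofReal_norm, hgf]
  have h0 : 0 ≤ ∑ i ∈ Finset.Ico p q, len i * levelMass f lam i :=
    Finset.sum_nonneg fun i _ => mul_nonneg (len_pos i).le (levelMass_nonneg f lam i)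
  have hlen := len_pos q
  have h := l2NormSq_posPart_indicator_le
    (measurableSet_T.diff (measurableSet_bigSet f lam p)) Set.sdiff_subset
    (hg.mono_set Set.sdiff_subset) hn
    (B := 180 * lam * ∑ i ∈ Finset.Ico p q, len i * levelMass f lam i +
        90 * lam * len q * ∫ x in T, ‖f x‖) (by positivity)
    (by rw [hen]; exact lintegral_energy_compl_le hf hlam hb hbq p)
  refine h.trans ?_
  have h5 : ∑ i ∈ Finset.Ico p q, n * len i * levelMass f lam i =
      n * ∑ i ∈ Finset.Ico p q, len i * levelMass f lam i := by
    rw [Finset.mul_sum]; exact Finset.sum_congr rfl fun i _ => by ring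
  rw [h5]
  have h6 : lam * (∫ x in T, ‖f x‖) * (n * len q) ≤ lam * (∫ x in T, ‖f x‖) * 3.1416 := by
    gcongr; exact hlq.trans hpi2.le
  have h7 : 0 ≤ lam * (n * ∑ i ∈ Finset.Ico p q, len i * levelMass f lam i) := by positivity
  have h8 : 0 ≤ lam * ∫ x in T, ‖f x‖ := by positivity
  nlinarith

end

/-! ### The contribution of the large selected intervals -/

section

variable {f : ℝ → ℂ} {lam : ℝ}

/-- The bumps adapted to the selected intervals satisfy a square function estimate. -/
theorem integral_sum_phi_sq_le (f : ℝ → ℂ) (lam : ℝ) (p : ℕ) :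
    ∫ y in T, (∑ r ∈ czFinset f lam p, phi (len r.1) y (left r)) ^ 2 ≤
      1200 * ∑ r ∈ czFinset f lam p, len r.1 := by
  set F := czFinset f lam p
  have hF : ∀ r ∈ F, r ∈ dyadicIndex := fun r hr => (mem_czFamily.1 (mem_czFinset.1 hr).1).1
  set A : ℕ × ℤ → ℕ × ℤ → ℝ := fun r s =>
    ∫ y in T, phi (len r.1) y (left r) * phi (len s.1) y (left s) with hA
  set B : ℕ × ℤ → ℕ × ℤ → ℝ := fun r s =>
    120 * ∫ y in dyadicInterval s.1 s.2, phi (len r.1) y (left r) with hB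
  have hB0 : ∀ r s, 0 ≤ B r s := fun r s =>
    mul_nonneg (by norm_num) (integral_nonneg fun y => phi_nonneg _ _ _)
  -- The interaction of two bumps is charged to the mass of the wider bump on the shorter interval
  -- (`120 = 40 · 3`). For fixed `r` these masses live on disjoint intervals, so they sum to at most
  -- the integral of one bump.
  have hAB1 : ∀ r, ∀ s ∈ F, len s.1 ≤ len r.1 → A r s ≤ B r s := fun r s hs hl => by
    have h1 := integral_phi_mul_phi_le (len_pos s.1) hl (left r) (left s)
    have h2 := len_mul_phi_le hl (left_mem s.1 s.2) (hF s hs) (left r)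
    rw [phi_comm] at h1
    simp only [hA, hB]
    change _ * phi _ (left s) _ ≤ _ at h2
    linarith
  have hAc : ∀ r s, A r s = A s r := fun r s => by simp only [hA, mul_comm]
  have hAB : ∀ r ∈ F, ∀ s ∈ F, A r s ≤ B r s + B s r := fun r hr s hs => by
    rcases le_total (len s.1) (len r.1) with h | h
    · linarith [hAB1 r s hs h, hB0 s r]
    · rw [hAc]; linarith [hAB1 s r hr h, hB0 r s]
  have hBsum : ∀ r, ∑ s ∈ F, B r s ≤ 600 * len r.1 := fun r => by
    have hr := len_pos r.1
    have hi := integrableOn_T_of_continuous (continuous_phi_left hr (left r))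
    have hiu : ∑ s ∈ F, ∫ y in dyadicInterval s.1 s.2, phi (len r.1) y (left r) =
        ∫ y in bigSet f lam p, phi (len r.1) y (left r) :=
      (integral_biUnion_finset _ (fun s _ => measurableSet_dyadicInterval s.1 s.2)
        (pairwise_disjoint_czFinset f lam p)
        fun s hs => hi.mono_set (dyadicInterval_subset_T (hF s hs))).symm
    have hle : ∫ y in bigSet f lam p, phi (len r.1) y (left r) ≤
        ∫ y in T, phi (len r.1) y (left r) :=
      setIntegral_mono_set hi (Filter.Eventually.of_forall fun y => phi_nonneg _ _ _)
        (bigSet_subset_T f lam p).eventuallyLE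
    simp only [hB]
    rw [← Finset.mul_sum, hiu]
    linarith [integral_phi_le hr (left r)]
  have hexp : ∀ y, (∑ r ∈ F, phi (len r.1) y (left r)) ^ 2 =
      ∑ r ∈ F, ∑ s ∈ F, phi (len r.1) y (left r) * phi (len s.1) y (left s) := fun y => by
    rw [sq, Finset.sum_mul_sum]
  have hint : ∀ r s : ℕ × ℤ, IntegrableOn
      (fun y => phi (len r.1) y (left r) * phi (len s.1) y (left s)) T := fun r s =>
    integrableOn_T_of_continuous ((continuous_phi_left (len_pos _) _).mul
      (continuous_phi_left (len_pos _) _))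
  simp only [hexp]
  rw [integral_finsetSum _ fun r _ => integrable_finsetSum _ fun s _ => hint r s]
  calc ∑ r ∈ F, ∫ y in T, ∑ s ∈ F, phi (len r.1) y (left r) * phi (len s.1) y (left s)
      = ∑ r ∈ F, ∑ s ∈ F, A r s :=
        Finset.sum_congr rfl fun r _ => integral_finsetSum _ fun s _ => hint r s
    _ ≤ ∑ r ∈ F, ∑ s ∈ F, (B r s + B s r) :=
        Finset.sum_le_sum fun r hr => Finset.sum_le_sum fun s hs => hAB r hr s hs
    _ = 2 * ∑ r ∈ F, ∑ s ∈ F, B r s := by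
        simp only [Finset.sum_add_distrib]
        rw [Finset.sum_comm (f := fun r s => B s r), two_mul]
    _ ≤ 2 * ∑ r ∈ F, 600 * len r.1 := by
        gcongr with r
        exact hBsum r
    _ = 1200 * ∑ r ∈ F, len r.1 := by rw [← Finset.mul_sum]; ring

/-! ### The Calderón–Zygmund decomposition of the modulated function -/

/-- The mean value of `h` over a dyadic interval. -/
def mean (h : ℝ → ℂ) (r : ℕ × ℤ) : ℂ := (∫ x in dyadicInterval r.1 r.2, h x) / len r.1

/-- The conditional expectation of `h` on the selected intervals. -/
def good (h : ℝ → ℂ) (F : Finset (ℕ × ℤ)) (x : ℝ) : ℂ :=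
  ∑ r ∈ F, (dyadicInterval r.1 r.2).indicator (fun _ => mean h r) x

theorem norm_mean_le (hf : IntegrableOn f T)
    (hlam : (∫ x in T, ‖f x‖) / (2 * Real.pi) < lam) {h : ℝ → ℂ} (hh : ∀ x, ‖h x‖ = ‖f x‖)
    {r : ℕ × ℤ} (hr : r ∈ czFamily f lam) : ‖mean h r‖ ≤ 2 * lam := by
  have hl := len_pos r.1
  rw [mean, norm_div, Complex.norm_real, Real.norm_of_nonneg hl.le, div_le_iff₀ hl]
  refine (norm_integral_le_integral_norm _).trans ?_
  simp only [hh]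
  exact integral_le_of_mem_czFamily hf hlam hr

theorem norm_good_sq (h : ℝ → ℂ) (p : ℕ) (x : ℝ) :
    ‖good h (czFinset f lam p) x‖ ^ 2 = ∑ r ∈ czFinset f lam p,
      (dyadicInterval r.1 r.2).indicator (fun _ => ‖mean h r‖ ^ 2) x := by
  by_cases hx : ∃ r ∈ czFinset f lam p, x ∈ dyadicInterval r.1 r.2
  · obtain ⟨r, hr, hxr⟩ := hx
    have hne : ∀ s ∈ czFinset f lam p, s ≠ r → x ∉ dyadicInterval s.1 s.2 :=
      fun s hs hsr hxs => Set.disjoint_left.1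
        (pairwise_disjoint_czFinset f lam p hs hr hsr) hxs hxr
    rw [good, Finset.sum_eq_single_of_mem r hr, Finset.sum_eq_single_of_mem r hr,
      Set.indicator_of_mem hxr, Set.indicator_of_mem hxr]
    · exact fun s hs hsr => Set.indicator_of_notMem (hne s hs hsr) _
    · exact fun s hs hsr => Set.indicator_of_notMem (hne s hs hsr) _
  · push Not at hx
    rw [good, Finset.sum_eq_zero fun r hr => Set.indicator_of_notMem (hx r hr) _,
      Finset.sum_eq_zero fun r hr => Set.indicator_of_notMem (hx r hr) _, norm_zero]
    norm_num

theorem integrableOn_indicator_const {E : Type*} [NormedAddCommGroup E] (r : ℕ × ℤ) (c : E) :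
    IntegrableOn ((dyadicInterval r.1 r.2).indicator fun _ => c) T :=
  (integrableOn_T_of_continuous continuous_const).indicator (measurableSet_dyadicInterval r.1 r.2)

theorem integrableOn_good (h : ℝ → ℂ) (F : Finset (ℕ × ℤ)) : IntegrableOn (good h F) T := by
  unfold good
  exact integrable_finsetSum _ fun r _ => integrableOn_indicator_const r _

/-- By disjointness `∫ |good|²` is at most `(2 lam)² ∑ |I|`, and one factor `lam` turns `∑ |I|` into
`‖f‖₁`. -/
theorem l2NormSq_demod_good_le (hf : IntegrableOn f T)
    (hlam : (∫ x in T, ‖f x‖) / (2 * Real.pi) < lam) {h : ℝ → ℂ} (hh : ∀ x, ‖h x‖ = ‖f x‖)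
    (n p : ℕ) :
    l2NormSq (demod n (good h (czFinset f lam p))) ≤ 4 * lam * ∫ x in T, ‖f x‖ := by
  have hl0 := lam_nonneg hlam
  have hi : ∀ r ∈ czFinset f lam p, IntegrableOn
      ((dyadicInterval r.1 r.2).indicator fun _ => ‖mean h r‖ ^ 2) T :=
    fun r _ => integrableOn_indicator_const r _
  refine (l2NormSq_demod_le n (integrableOn_good h _) ?_).trans ?_
  · simp only [norm_good_sq]
    exact integrable_finsetSum _ hi
  simp only [norm_good_sq]
  rw [integral_finsetSum _ hi]
  calc ∑ r ∈ czFinset f lam p,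
        ∫ x in T, (dyadicInterval r.1 r.2).indicator (fun _ => ‖mean h r‖ ^ 2) x
      ≤ ∑ r ∈ czFinset f lam p, 4 * lam ^ 2 * len r.1 := by
        refine Finset.sum_le_sum fun r hr => ?_
        have hr' := (mem_czFinset.1 hr).1
        rw [setIntegral_indicator (measurableSet_dyadicInterval r.1 r.2),
          Set.inter_eq_right.2 (dyadicInterval_subset_T (mem_czFamily.1 hr').1),
          setIntegral_const, volume_real_dyadicInterval, smul_eq_mul, mul_comm]
        have h1 := norm_mean_le hf hlam hh hr'
        have h2 : ‖mean h r‖ ^ 2 ≤ (2 * lam) ^ 2 := by gcongr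
        have h3 := len_pos r.1
        nlinarith
    _ = 4 * lam * (lam * ∑ r ∈ czFinset f lam p, len r.1) := by rw [← Finset.mul_sum]; ring
    _ ≤ 4 * lam * ∫ x in T, ‖f x‖ := by
        gcongr
        exact sum_len_czFinset_le hf p

/-- The part of the demodulated operator that comes from the oscillation of `h` on an interval. -/
def badTerm (n : ℕ) (h : ℝ → ℂ) (r : ℕ × ℤ) (y : ℝ) : ℂ :=
  1 / (2 * Real.pi) * ∫ x in dyadicInterval r.1 r.2, (h x - mean h r) * ker n (cis (y - x))

theorem integrableOn_mul_ker {h : ℝ → ℂ} {s : Set ℝ} (hh : IntegrableOn h s) (n : ℕ) (y : ℝ) :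
    IntegrableOn (fun x => h x * ker n (cis (y - x))) s :=
  hh.mul_bdd (c := n)
    ((continuous_ker n).comp (continuous_cis.comp (continuous_const.sub continuous_id))).aestronglyMeasurable
    (Filter.Eventually.of_forall fun _ => norm_ker_le n (norm_cis _).le)

theorem integrableOn_const_dyadic {E : Type*} [NormedAddCommGroup E] {r : ℕ × ℤ}
    (hr : r ∈ dyadicIndex) (c : E) :
    IntegrableOn (fun _ : ℝ => c) (dyadicInterval r.1 r.2) :=
  (integrableOn_T_of_continuous continuous_const).mono_set (dyadicInterval_subset_T hr)

theorem demod_indicator_bigSet {h : ℝ → ℂ} (hh : IntegrableOn h T) (n p : ℕ) (y : ℝ) :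
    demod n ((bigSet f lam p).indicator h) y =
      demod n (good h (czFinset f lam p)) y + ∑ r ∈ czFinset f lam p, badTerm n h r y := by
  have hidx : ∀ r ∈ czFinset f lam p, r ∈ dyadicIndex :=
    fun r hr => (mem_czFamily.1 (mem_czFinset.1 hr).1).1
  have hhr : ∀ r ∈ czFinset f lam p, IntegrableOn h (dyadicInterval r.1 r.2) :=
    fun r hr => hh.mono_set (dyadicInterval_subset_T (hidx r hr))
  have hQ := measurableSet_bigSet f lam p
  have h1 : demod n ((bigSet f lam p).indicator h) y = ∑ r ∈ czFinset f lam p,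
      1 / (2 * Real.pi) * ∫ x in dyadicInterval r.1 r.2, h x * ker n (cis (y - x)) := by
    rw [demod_eq_integral n (hh.indicator hQ), ← Finset.mul_sum]
    congr 1
    have : ∀ x, (bigSet f lam p).indicator h x * ker n (cis (y - x)) =
        (bigSet f lam p).indicator (fun x => h x * ker n (cis (y - x))) x :=
      fun x => by by_cases hx : x ∈ bigSet f lam p <;> simp [hx]
    simp only [this]
    rw [setIntegral_indicator hQ, Set.inter_eq_right.2 (bigSet_subset_T f lam p)]
    exact integral_biUnion_finset _ (fun r _ => measurableSet_dyadicInterval r.1 r.2)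
      (pairwise_disjoint_czFinset f lam p) fun r hr => integrableOn_mul_ker (hhr r hr) n y
  have h2 : demod n (good h (czFinset f lam p)) y = ∑ r ∈ czFinset f lam p,
      1 / (2 * Real.pi) * ∫ x in dyadicInterval r.1 r.2, mean h r * ker n (cis (y - x)) := by
    rw [demod_eq_integral n (integrableOn_good h _), ← Finset.mul_sum]
    congr 1
    have : ∀ x, good h (czFinset f lam p) x * ker n (cis (y - x)) = ∑ r ∈ czFinset f lam p,
        (dyadicInterval r.1 r.2).indicator (fun x => mean h r * ker n (cis (y - x))) x := by
      intro x
      rw [good, Finset.sum_mul]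
      refine Finset.sum_congr rfl fun r _ => ?_
      by_cases hx : x ∈ dyadicInterval r.1 r.2 <;> simp [hx]
    simp only [this]
    rw [integral_finsetSum]
    · refine Finset.sum_congr rfl fun r hr => ?_
      rw [setIntegral_indicator (measurableSet_dyadicInterval r.1 r.2),
        Set.inter_eq_right.2 (dyadicInterval_subset_T (hidx r hr))]
    · exact fun r _ => IntegrableOn.indicator (integrableOn_mul_ker (h := fun _ => mean h r)
        (integrableOn_T_of_continuous continuous_const) n y) (measurableSet_dyadicInterval r.1 r.2)
  rw [h1, h2, ← Finset.sum_add_distrib]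
  refine Finset.sum_congr rfl fun r hr => ?_
  have hc := integrableOn_const_dyadic (hidx r hr) (mean h r)
  have hhc : IntegrableOn (fun x => h x - mean h r) (dyadicInterval r.1 r.2) := (hhr r hr).sub hc
  rw [badTerm, ← mul_add, ← integral_add (integrableOn_mul_ker hc n y)
    (integrableOn_mul_ker hhc n y)]
  congr 1
  refine integral_congr_ae (Filter.Eventually.of_forall fun x => ?_)
  ring

theorem integral_norm_sub_mean_le (hf : IntegrableOn f T)
    (hlam : (∫ x in T, ‖f x‖) / (2 * Real.pi) < lam) {h : ℝ → ℂ} (hhi : IntegrableOn h T)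
    (hh : ∀ x, ‖h x‖ = ‖f x‖) {r : ℕ × ℤ} (hr : r ∈ czFamily f lam) :
    ∫ x in dyadicInterval r.1 r.2, ‖h x - mean h r‖ ≤ 4 * lam * len r.1 := by
  have hidx := (mem_czFamily.1 hr).1
  have hhr := hhi.mono_set (dyadicInterval_subset_T hidx)
  have hc := integrableOn_const_dyadic hidx (mean h r)
  calc ∫ x in dyadicInterval r.1 r.2, ‖h x - mean h r‖
      ≤ ∫ x in dyadicInterval r.1 r.2, (‖h x‖ + ‖mean h r‖) :=
        integral_mono (hhr.sub hc).norm (hhr.norm.add hc.norm) fun x => norm_sub_le _ _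
    _ = (∫ x in dyadicInterval r.1 r.2, ‖h x‖) + len r.1 * ‖mean h r‖ := by
        rw [integral_add hhr.norm hc.norm, setIntegral_const, volume_real_dyadicInterval,
          smul_eq_mul]
    _ ≤ 2 * lam * len r.1 + len r.1 * (2 * lam) := by
        have hl := (len_pos r.1).le
        gcongr
        · simp only [hh]; exact integral_le_of_mem_czFamily hf hlam hr
        · exact norm_mean_le hf hlam hh hr
    _ = 4 * lam * len r.1 := by ring

theorem integral_sub_mean {h : ℝ → ℂ} {r : ℕ × ℤ} (hr : r ∈ dyadicIndex)
    (hh : IntegrableOn h (dyadicInterval r.1 r.2)) :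
    ∫ x in dyadicInterval r.1 r.2, (h x - mean h r) = 0 := by
  have hl : (len r.1 : ℂ) ≠ 0 := by exact_mod_cast (len_pos r.1).ne'
  rw [integral_sub hh (integrableOn_const_dyadic hr _), setIntegral_const,
    volume_real_dyadicInterval, Complex.real_smul, mean, mul_div_cancel₀ _ hl, sub_self]

/-- Bound for `badTerm` from a bound for the oscillation of the kernel. -/
theorem norm_badTerm_le (hf : IntegrableOn f T)
    (hlam : (∫ x in T, ‖f x‖) / (2 * Real.pi) < lam) {h : ℝ → ℂ} (hhi : IntegrableOn h T)
    (hh : ∀ x, ‖h x‖ = ‖f x‖) {r : ℕ × ℤ} (hr : r ∈ czFamily f lam) (n : ℕ) (y : ℝ) (c : ℂ)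
    {K : ℝ} (hK0 : 0 ≤ K) (hK : ∀ x ∈ dyadicInterval r.1 r.2, ‖ker n (cis (y - x)) - c‖ ≤ K) :
    ‖badTerm n h r y‖ ≤ K * (lam * len r.1) := by
  have hidx := (mem_czFamily.1 hr).1
  have hhr := hhi.mono_set (dyadicInterval_subset_T hidx)
  have hhc : IntegrableOn (fun x => h x - mean h r) (dyadicInterval r.1 r.2) :=
    hhr.sub (integrableOn_const_dyadic hidx (mean h r))
  have hl0 := lam_nonneg hlam
  have hl := len_pos r.1
  -- Since `h - mean h r` has integral zero, any constant `c` may be subtracted from the kernel.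
  -- Below, `c = 0` serves near the interval and the kernel value at `left r` serves far from it.
  have h1 : ∫ x in dyadicInterval r.1 r.2, (h x - mean h r) * ker n (cis (y - x)) =
      ∫ x in dyadicInterval r.1 r.2, (h x - mean h r) * (ker n (cis (y - x)) - c) := by
    simp only [mul_sub]
    rw [integral_sub (integrableOn_mul_ker hhc n y) (hhc.mul_const c), integral_mul_const,
      integral_sub_mean hidx hhr, zero_mul, sub_zero]
  rw [badTerm, h1, norm_mul, norm_one_div_two_pi]
  have h2 : ‖∫ x in dyadicInterval r.1 r.2, (h x - mean h r) * (ker n (cis (y - x)) - c)‖ ≤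
      K * (4 * lam * len r.1) := by
    calc _ ≤ ∫ x in dyadicInterval r.1 r.2, K * ‖h x - mean h r‖ := by
          refine norm_integral_le_of_norm_le (hhc.norm.const_mul K) ?_
          filter_upwards [ae_restrict_mem (measurableSet_dyadicInterval r.1 r.2)] with x hx
          rw [norm_mul, mul_comm]
          gcongr
          exact hK x hx
      _ = K * ∫ x in dyadicInterval r.1 r.2, ‖h x - mean h r‖ := integral_const_mul _ _
      _ ≤ K * (4 * lam * len r.1) := by
          gcongr
          exact integral_norm_sub_mean_le hf hlam hhi hh hr
  have hpi := Real.pi_gt_three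
  rw [one_div, inv_mul_le_iff₀ (by positivity)]
  have : 0 ≤ K * (lam * len r.1) := by positivity
  nlinarith

/-- The weight compensates the size of `badTerm` near the interval. -/
theorem norm_badTerm_mul_le (hf : IntegrableOn f T)
    (hlam : (∫ x in T, ‖f x‖) / (2 * Real.pi) < lam) {h : ℝ → ℂ} (hhi : IntegrableOn h T)
    (hh : ∀ x, ‖h x‖ = ‖f x‖) {r : ℕ × ℤ} (hr : r ∈ czFamily f lam) {n : ℕ} (hn : 1 ≤ n)
    {E : Set ℝ} (hE : MeasurableSet E) (hfar : ∀ x ∈ E, 5 / 2 * len r.1 ≤ rho x (left r)) (y : ℝ) :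
    ‖badTerm n h r y‖ * ‖fejerMean (n / 10) (E.indicator fun _ => (1 : ℂ)) y‖ ≤
      1000 * lam * phi (len r.1) y (left r) := by
  have hl0 := lam_nonneg hlam
  have ha := len_pos r.1
  set a := len r.1 with ha'
  have hn0 : (0 : ℝ) < n := by exact_mod_cast hn
  set ρ := rho y (left r) with hρ
  have hρ0 : 0 ≤ ρ := rho_nonneg _ _
  have hφ := phi_nonneg a y (left r)
  have hw1 := norm_fejerMean_indicator_le_one (n / 10) hE y
  -- Near: `y` is within `2a` of the left end while `E` stays `5a/2` away, so `E` is at distance at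
  -- least `a/2` from `y`; the Fejér decay `20/((⌊n/10⌋ + 1) a)` cancels the crude kernel bound `n`.
  -- Far: `ρ ≥ 2a` keeps every `x` in the interval at distance at least `ρ/2` from `y`, and
  -- regularity gives `6a/(ρ²/2)`.
  rcases lt_or_ge ρ (2 * a) with hnear | hfar'
  · have h1 : ‖badTerm n h r y‖ ≤ n * (lam * a) :=
      norm_badTerm_le hf hlam hhi hh hr n y 0 hn0.le fun x _ => by
        rw [sub_zero]; exact norm_ker_le n (norm_cis _).le
    have h2 : ‖fejerMean (n / 10) (E.indicator fun _ => (1 : ℂ)) y‖ ≤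
        20 / ((n / 10 + 1 : ℕ) * a) := by
      refine norm_fejerMean_indicator_le (n / 10) hE ha fun x hx => ?_
      have h3 := hfar x hx
      have h4 := rho_triangle x y (left r)
      linarith
    have h3 : (n : ℝ) ≤ 10 * (n / 10 + 1 : ℕ) := by
      have : n ≤ 10 * (n / 10 + 1) := by omega
      exact_mod_cast this
    have h4 : 1 / 5 ≤ phi a y (left r) := by
      rw [phi, div_le_div_iff₀ (by norm_num) (phi_den_pos ha _ _)]
      have : ρ ^ 2 ≤ (2 * a) ^ 2 := by gcongr
      nlinarith
    have h5 : (0 : ℝ) < (n / 10 + 1 : ℕ) := by positivity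
    calc _ ≤ n * (lam * a) * (20 / ((n / 10 + 1 : ℕ) * a)) := by gcongr
      _ = 20 * lam * (n / (n / 10 + 1 : ℕ)) := by field_simp
      _ ≤ 20 * lam * 10 := by
          gcongr
          rwa [div_le_iff₀ h5]
      _ ≤ 1000 * lam * phi a y (left r) := by nlinarith
  · have hρp : 0 < ρ := by linarith
    have h1 : ‖badTerm n h r y‖ ≤ 12 * a / ρ ^ 2 * (lam * a) := by
      refine norm_badTerm_le hf hlam hhi hh hr n y (ker n (cis (y - left r))) (by positivity)
        fun x hx => ?_
      have hxl := rho_of_mem_dyadicInterval hx (left_mem r.1 r.2)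
      change rho x (left r) ≤ a at hxl
      have hxy : ρ / 2 ≤ rho y x := by
        have := rho_triangle y x (left r)
        linarith
      have h2 := norm_ker_sub_ker_le hn (norm_cis (y - x)).le (norm_cis (y - left r)).le
      rw [← rho_eq_norm_one_sub, ← rho_eq_norm_one_sub, ← hρ] at h2
      have h3 : ‖cis (y - x) - cis (y - left r)‖ = rho x (left r) := by
        change rho (y - x) (y - left r) = _
        rw [rho_eq_norm_one_sub, rho_comm, rho_eq_norm_one_sub]
        congr 3; ring
      rw [h3] at h2
      rw [le_div_iff₀ (by positivity)]
      have h4 : ‖ker n (cis (y - x)) - ker n (cis (y - left r))‖ * (ρ / 2 * ρ) ≤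
          ‖ker n (cis (y - x)) - ker n (cis (y - left r))‖ * (rho y x * ρ) := by gcongr
      nlinarith
    calc _ ≤ 12 * a / ρ ^ 2 * (lam * a) * 1 := by gcongr
      _ ≤ 1000 * lam * phi a y (left r) := by
          have : 12 * a / ρ ^ 2 * (lam * a) * 1 = 12 * lam * (a ^ 2 / ρ ^ 2) := by ring
          rw [this]
          have h6 : a ^ 2 / ρ ^ 2 ≤ 2 * phi a y (left r) := by
            rw [phi, ← mul_div_assoc, div_le_div_iff₀ (by positivity) (phi_den_pos ha _ _), ← hρ]
            have : (2 * a) ^ 2 ≤ ρ ^ 2 := by gcongr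
            nlinarith [sq_nonneg a]
          nlinarith [mul_nonneg hl0 hφ, mul_le_mul_of_nonneg_left h6 hl0]

/-- The contribution of the large intervals, damped by the weight. -/
theorem l2NormSq_posPart_bigSet_le (hf : IntegrableOn f T)
    (hlam : (∫ x in T, ‖f x‖) / (2 * Real.pi) < lam) {g : ℝ → ℂ} (hg : IntegrableOn g T)
    (hgf : ∀ x, ‖g x‖ = ‖f x‖) {n : ℕ} (hn : 1 ≤ n) (p : ℕ) {E : Set ℝ} (hE : MeasurableSet E)
    (hfar : ∀ r ∈ czFinset f lam p, ∀ x ∈ E, 5 / 2 * len r.1 ≤ rho x (left r)) :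
    l2NormSq (fun y => posPart n ((bigSet f lam p).indicator g) y *
      fejerMean (n / 10) (E.indicator fun _ => (1 : ℂ)) y) ≤
        3000000000 * lam * ∫ x in T, ‖f x‖ := by
  have hl0 := lam_nonneg hlam
  have hfn : 0 ≤ ∫ x in T, ‖f x‖ := integral_nonneg fun _ => norm_nonneg _
  set F := czFinset f lam p with hF
  set h : ℝ → ℂ := fun x => g x * ex (-n) x with hh
  have hhi : IntegrableOn h T := integrableOn_mul_ex hg _
  have hhf : ∀ x, ‖h x‖ = ‖f x‖ := fun x => by rw [hh, norm_mul, norm_ex, mul_one, hgf]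
  have hind : (fun x => (bigSet f lam p).indicator g x * ex (-n) x) =
      (bigSet f lam p).indicator h := by
    ext x; by_cases hx : x ∈ bigSet f lam p <;> simp [hx, hh]
  set Φ : ℝ → ℝ := fun y => ∑ r ∈ F, phi (len r.1) y (left r) with hΦ
  have hΦc : Continuous Φ := continuous_finsetSum _ fun r _ =>
    continuous_phi_left (len_pos r.1) (left r)
  have hpt : ∀ y, ‖posPart n ((bigSet f lam p).indicator g) y *
      fejerMean (n / 10) (E.indicator fun _ => (1 : ℂ)) y‖ ^ 2 ≤
        2 * ‖demod n (good h F) y‖ ^ 2 + 2000000 * lam ^ 2 * Φ y ^ 2 := fun y => by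
    have hw1 := norm_fejerMean_indicator_le_one (n / 10) hE y
    have h1 : ‖∑ r ∈ F, badTerm n h r y‖ *
        ‖fejerMean (n / 10) (E.indicator fun _ => (1 : ℂ)) y‖ ≤ 1000 * lam * Φ y := by
      rw [hΦ, Finset.mul_sum]
      refine (mul_le_mul_of_nonneg_right (norm_sum_le _ _) (norm_nonneg _)).trans ?_
      rw [Finset.sum_mul]
      exact Finset.sum_le_sum fun r hr => norm_badTerm_mul_le hf hlam hhi hhf
        (mem_czFinset.1 hr).1 hn hE (hfar r hr) y
    have h2 : ‖posPart n ((bigSet f lam p).indicator g) y *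
        fejerMean (n / 10) (E.indicator fun _ => (1 : ℂ)) y‖ ≤
          ‖demod n (good h F) y‖ + 1000 * lam * Φ y := by
      rw [posPart_eq_demod, hind, demod_indicator_bigSet hhi, norm_mul, norm_mul, norm_ex, one_mul]
      refine (mul_le_mul_of_nonneg_right (norm_add_le _ _) (norm_nonneg _)).trans ?_
      rw [add_mul]
      exact add_le_add (mul_le_of_le_one_right (norm_nonneg _) hw1) h1
    have h3 := norm_nonneg (posPart n ((bigSet f lam p).indicator g) y *
        fejerMean (n / 10) (E.indicator fun _ => (1 : ℂ)) y)
    have h4 := pow_le_pow_left₀ h3 h2 2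
    nlinarith [sq_nonneg (‖demod n (good h F) y‖ - 1000 * lam * Φ y)]
  have hi1 : IntegrableOn (fun y => ‖demod n (good h F) y‖ ^ 2) T :=
    integrableOn_T_of_continuous ((continuous_demod _ _).norm.pow 2)
  have hi2 : IntegrableOn (fun y => Φ y ^ 2) T := integrableOn_T_of_continuous (hΦc.pow 2)
  calc l2NormSq (fun y => posPart n ((bigSet f lam p).indicator g) y *
        fejerMean (n / 10) (E.indicator fun _ => (1 : ℂ)) y)
      ≤ ∫ y in T, (2 * ‖demod n (good h F) y‖ ^ 2 + 2000000 * lam ^ 2 * Φ y ^ 2) :=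
        integral_mono_of_nonneg (Filter.Eventually.of_forall fun y => by positivity)
          ((hi1.const_mul _).add (hi2.const_mul _)) (Filter.Eventually.of_forall hpt)
    _ = 2 * l2NormSq (demod n (good h F)) + 2000000 * lam ^ 2 * ∫ y in T, Φ y ^ 2 := by
        rw [integral_add (hi1.const_mul _) (hi2.const_mul _), integral_const_mul,
          integral_const_mul, l2NormSq]
    _ ≤ 2 * (4 * lam * ∫ x in T, ‖f x‖) +
          2000000 * lam ^ 2 * (1200 * ∑ r ∈ F, len r.1) := by
        gcongr
        · exact l2NormSq_demod_good_le hf hlam hhf n p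
        · exact integral_sum_phi_sq_le f lam p
    _ = 8 * (lam * ∫ x in T, ‖f x‖) + 2400000000 * lam * (lam * ∑ r ∈ F, len r.1) := by ring
    _ ≤ 8 * (lam * ∫ x in T, ‖f x‖) + 2400000000 * lam * ∫ x in T, ‖f x‖ := by
        gcongr
        exact sum_len_czFinset_le hf p
    _ ≤ 3000000000 * lam * ∫ x in T, ‖f x‖ := by
        have : 0 ≤ lam * ∫ x in T, ‖f x‖ := by positivity
        linarith

end

/-! ### Summation over the lacunary sequence -/

theorem sum_Icc_le_two_mul {a : ℕ → ℝ} (ha : ∀ j, 0 ≤ a j) (h2 : ∀ j, 1 ≤ j → 2 * a j ≤ a (j + 1))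
    (N : ℕ) : ∑ j ∈ Finset.Icc 1 (N + 1), a j ≤ 2 * a (N + 1) := by
  induction N with
  | zero => simpa using by linarith [ha 1]
  | succ N ih =>
    rw [Finset.sum_Icc_succ_top (by omega)]
    linarith [h2 (N + 1) (by omega)]

/-- If the last term passes the truncation, the whole geometric sum is at most twice it; otherwise
the last term drops out. -/
theorem sum_Icc_truncated_le {a : ℕ → ℝ} (ha : ∀ j, 0 ≤ a j)
    (h2 : ∀ j, 1 ≤ j → 2 * a j ≤ a (j + 1)) {L : ℝ} (hL : 0 ≤ L) (N : ℕ) :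
    ∑ j ∈ Finset.Icc 1 N, (if a j ≤ L then a j else 0) ≤ 2 * L := by
  induction N with
  | zero => simpa using hL
  | succ N ih =>
    by_cases h : a (N + 1) ≤ L
    · refine (Finset.sum_le_sum fun j _ => ?_).trans ((sum_Icc_le_two_mul ha h2 N).trans ?_)
      · split_ifs
        exacts [le_rfl, ha j]
      · linarith
    · rw [Finset.sum_Icc_succ_top (by omega), if_neg h, add_zero]
      exact ih

/-- Translates the length cutoff in `dilatedSet` into the level cutoff in `bigSet`. -/
theorem exists_level {ε : ℝ} (hε : 0 < ε) : ∃ P : ℕ, ∀ p, ε < len p ↔ p < P := by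
  have hex : ∃ p, len p ≤ ε := by
    obtain ⟨p, hp⟩ := pow_unbounded_of_one_lt (2 * Real.pi / ε) (one_lt_two (α := ℝ))
    refine ⟨p, ?_⟩
    rw [div_lt_iff₀ hε] at hp
    rw [len, div_le_iff₀ (by positivity)]
    linarith
  classical
  refine ⟨Nat.find hex, fun p => ?_⟩
  rw [Nat.lt_find_iff]
  exact ⟨fun h q hq => not_le.2 (h.trans_le (len_antitone hq)), fun h => not_le.1 (h p le_rfl)⟩

theorem posPart_eq_add {f : ℝ → ℂ} (hf : IntegrableOn f T) {Q : Set ℝ} (hQ : MeasurableSet Q)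
    (hQT : Q ⊆ T) (n : ℕ) (y : ℝ) :
    posPart n f y = posPart n (Q.indicator f) y + posPart n ((T \ Q).indicator f) y := by
  simp only [posPart]
  rw [← Finset.sum_add_distrib]
  refine Finset.sum_congr rfl fun k _ => ?_
  rw [← add_mul, ← mul_add, coeff_indicator hQ hQT,
    coeff_indicator (measurableSet_T.diff hQ) Set.sdiff_subset, coeff_eq, ← mul_add,
    setIntegral_sdiff hQ (integrableOn_mul_ex hf _) hQT, add_sub_cancel]

theorem continuous_posPart (n : ℕ) (f : ℝ → ℂ) : Continuous (posPart n f) := by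
  unfold posPart; fun_prop

section

variable {f : ℝ → ℂ} {lam : ℝ}

theorem threshold_pos {n : ℕ → ℕ} {j : ℕ} (hj : 1 ≤ j) (hn : 1 ≤ n j) : 0 < threshold n j := by
  have h1 : (0 : ℝ) < j := by exact_mod_cast hj
  have h2 : (0 : ℝ) < n j := by exact_mod_cast hn
  have h3 : 0 < Real.log ((j : ℝ) + 1) := Real.log_pos (by linarith)
  rw [threshold]; positivity

/-- The weight is kept on the part of `g` in `bigSet`, where it is indispensable, and bounded by one
on the rest. The function `g` stands for `f` or its conjugate, which share the family selected for
`f`. -/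
theorem l2NormSq_posPart_mul_le (hf : IntegrableOn f T)
    (hlam : (∫ x in T, ‖f x‖) / (2 * Real.pi) < lam) {g : ℝ → ℂ} (hg : IntegrableOn g T)
    (hgf : ∀ x, ‖g x‖ = ‖f x‖) {n : ℕ} (hn : 1 ≤ n) (p : ℕ) {E : Set ℝ} (hE : MeasurableSet E)
    (hfar : ∀ r ∈ czFinset f lam p, ∀ x ∈ E, 5 / 2 * len r.1 ≤ rho x (left r)) :
    l2NormSq (fun y => posPart n g y * fejerMean (n / 10) (E.indicator fun _ => (1 : ℂ)) y) ≤
      7000000000 * lam * (∫ x in T, ‖f x‖) + 40000 * lam *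
        ∑ i ∈ Finset.Ico p (Nat.log 2 (4 * n)), n * len i * levelMass f lam i := by
  have hl0 := lam_nonneg hlam
  have hfn : 0 ≤ ∫ x in T, ‖f x‖ := integral_nonneg fun _ => norm_nonneg _
  have h1 := l2NormSq_posPart_bigSet_le hf hlam hg hgf hn p hE hfar
  have h2 := l2NormSq_posPart_compl_le hf hlam hg hgf hn p
  set w := fejerMean (n / 10) (E.indicator fun _ => (1 : ℂ)) with hw
  have hwc : Continuous w := continuous_of_mem_trigSpan (fejerMean_mem _ _)
  set u := posPart n ((bigSet f lam p).indicator g) with hu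
  set v := posPart n ((T \ bigSet f lam p).indicator g) with hv
  have huc : Continuous u := continuous_posPart _ _
  have hvc : Continuous v := continuous_posPart _ _
  have hi1 : IntegrableOn (fun y => ‖u y * w y‖ ^ 2) T :=
    integrableOn_T_of_continuous (by fun_prop)
  have hi2 : IntegrableOn (fun y => ‖v y‖ ^ 2) T := integrableOn_T_of_continuous (by fun_prop)
  have hpt : ∀ y, ‖posPart n g y * w y‖ ^ 2 ≤ 2 * ‖u y * w y‖ ^ 2 + 2 * ‖v y‖ ^ 2 := fun y => by
    rw [posPart_eq_add hg (measurableSet_bigSet f lam p) (bigSet_subset_T f lam p), add_mul]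
    have h3 : ‖v y * w y‖ ≤ ‖v y‖ := by
      rw [norm_mul]
      exact mul_le_of_le_one_right (norm_nonneg _) (norm_fejerMean_indicator_le_one _ hE y)
    have h4 := (norm_add_le (u y * w y) (v y * w y)).trans (add_le_add_right h3 _)
    have h5 := pow_le_pow_left₀ (norm_nonneg _) h4 2
    nlinarith [sq_nonneg (‖u y * w y‖ - ‖v y‖)]
  have h6 : l2NormSq (fun y => posPart n g y * w y) ≤
      2 * l2NormSq (fun y => u y * w y) + 2 * l2NormSq v := by
    simp only [l2NormSq]
    rw [← integral_const_mul, ← integral_const_mul,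
      ← integral_add (hi1.const_mul 2) (hi2.const_mul 2)]
    exact integral_mono_of_nonneg (Filter.Eventually.of_forall fun y => by positivity)
      ((hi1.const_mul 2).add (hi2.const_mul 2)) (Filter.Eventually.of_forall hpt)
  have h7 : 0 ≤ lam * ∫ x in T, ‖f x‖ := by positivity
  nlinarith

theorem l2NormSq_term_le (hf : IntegrableOn f T)
    (hlam : (∫ x in T, ‖f x‖) / (2 * Real.pi) < lam) {β : ℕ} (hβ : 9 ≤ β) {n : ℕ → ℕ} {j : ℕ}
    (hn : 1 ≤ n j) {P : ℕ} (hP : ∀ p, threshold n j < len p ↔ p < P) :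
    l2NormSq (term f lam β n j) ≤
      28000000000 * lam * (∫ x in T, ‖f x‖) + 160000 * lam *
        ∑ i ∈ Finset.Ico P (Nat.log 2 (4 * n j)), n j * len i * levelMass f lam i := by
  set E := T \ dilatedSet f lam β (threshold n j) with hE
  have hEm : MeasurableSet E := measurableSet_T.diff (measurableSet_dilatedSet f lam β _)
  -- A point nearer than this would lie in `βI` for a selected `I` longer than the threshold, hence
  -- in the set that `E` omits.
  have hfar : ∀ r ∈ czFinset f lam P, ∀ x ∈ E, 5 / 2 * len r.1 ≤ rho x (left r) := by
    intro r hr x hx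
    by_contra! hlt
    obtain ⟨hr1, hr2⟩ := mem_czFinset.1 hr
    exact hx.2 (Set.mem_biUnion (t := fun p => dilate β p)
      (show r ∈ {p | p ∈ czFamily f lam ∧ threshold n j < 2 * Real.pi / 2 ^ p.1} from
        ⟨hr1, (hP r.1).2 hr2⟩) (mem_dilate hβ hx.1 hlt))
  set f' : ℝ → ℂ := fun x => (starRingEnd ℂ) (f x) with hf'
  have hf'n : ∀ x, ‖f' x‖ = ‖f x‖ := fun x => Complex.norm_conj _
  have hf'i : IntegrableOn f' T :=
    hf.congr' (Complex.continuous_conj.comp_aestronglyMeasurable hf.aestronglyMeasurable)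
      (Filter.Eventually.of_forall fun x => (hf'n x).symm)
  have h1 := l2NormSq_posPart_mul_le hf hlam hf (fun _ => rfl) hn P hEm hfar
  have h2 := l2NormSq_posPart_mul_le hf hlam hf'i hf'n hn P hEm hfar
  set w := fejerMean (n j / 10) (E.indicator fun _ => (1 : ℂ)) with hw
  have hwc : Continuous w := continuous_of_mem_trigSpan (fejerMean_mem _ _)
  have hi : ∀ g : ℝ → ℂ, IntegrableOn (fun y => ‖posPart (n j) g y * w y‖ ^ 2) T := fun g =>
    integrableOn_T_of_continuous (((continuous_posPart _ g).mul hwc).norm.pow 2)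
  have hpt : ∀ y, ‖term f lam β n j y‖ ^ 2 ≤
      2 * ‖posPart (n j) f y * w y‖ ^ 2 + 2 * ‖posPart (n j) f' y * w y‖ ^ 2 := fun y => by
    have h3 : ‖term f lam β n j y‖ ≤
        ‖posPart (n j) f y * w y‖ + ‖posPart (n j) f' y * w y‖ := by
      rw [term, partialSum_sub_vpMean hn, negPart_eq, norm_mul, norm_neg, norm_mul, norm_mul,
        ← add_mul]
      refine mul_le_mul_of_nonneg_right ((norm_add_le _ _).trans ?_) (norm_nonneg _)
      rw [Complex.norm_conj]
    have h5 := pow_le_pow_left₀ (norm_nonneg _) h3 2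
    nlinarith [sq_nonneg (‖posPart (n j) f y * w y‖ - ‖posPart (n j) f' y * w y‖)]
  have h6 : l2NormSq (term f lam β n j) ≤ 2 * l2NormSq (fun y => posPart (n j) f y * w y) +
      2 * l2NormSq (fun y => posPart (n j) f' y * w y) := by
    simp only [l2NormSq]
    rw [← integral_const_mul, ← integral_const_mul,
      ← integral_add ((hi f).const_mul 2) ((hi f').const_mul 2)]
    exact integral_mono_of_nonneg (Filter.Eventually.of_forall fun y => by positivity)
      (((hi f).const_mul 2).add ((hi f').const_mul 2)) (Filter.Eventually.of_forall hpt)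
  linarith

theorem sum_l2NormSq_term_le (hf : IntegrableOn f T)
    (hlam : (∫ x in T, ‖f x‖) / (2 * Real.pi) < lam) {β : ℕ} (hβ : 9 ≤ β) {n : ℕ → ℕ}
    (hn : ∀ j, 1 ≤ j → 1 ≤ n j) (hlac : ∀ j, 1 ≤ j → 2 * n j ≤ n (j + 1)) (N : ℕ) :
    ∑ j ∈ Finset.Icc 1 N, l2NormSq (term f lam β n j) ≤
      28000000000 * N * lam * (∫ x in T, ‖f x‖) + 320000 * lam *
        (20 * ((N : ℝ) + 1) * Real.log ((N : ℝ) + 1) ^ 2) * ∫ x in T, ‖f x‖ := by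
  have hl0 := lam_nonneg hlam
  set L : ℝ := 20 * ((N : ℝ) + 1) * Real.log ((N : ℝ) + 1) ^ 2 with hL
  have hL0 : 0 ≤ L := by positivity
  have hex : ∀ j, ∃ P : ℕ, 1 ≤ j → ∀ p, threshold n j < len p ↔ p < P := fun j => by
    by_cases hj : 1 ≤ j
    · obtain ⟨P, hP⟩ := exists_level (threshold_pos hj (hn j hj))
      exact ⟨P, fun _ => hP⟩
    · exact ⟨0, fun h => absurd h hj⟩
  choose P hP using hex
  -- Any common upper bound for the levels would do; it makes the range of `i` independent of `j`,
  -- so that the two sums can be exchanged. The dependence on `P j` is carried by the truncation in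
  -- `t`, since `len i ≤ threshold n j` forces `n j * len i ≤ L`.
  set R : ℕ := ∑ j ∈ Finset.Icc 1 N, Nat.log 2 (4 * n j) with hR
  set t : ℕ → ℕ → ℝ := fun j i => if n j * len i ≤ L then n j * len i else 0 with ht
  have ht0 : ∀ j i, 0 ≤ t j i := fun j i => by
    have := len_pos i
    simp only [ht]; split_ifs
    · positivity
    · exact le_rfl
  have hj : ∀ j ∈ Finset.Icc 1 N,
      ∑ i ∈ Finset.Ico (P j) (Nat.log 2 (4 * n j)), n j * len i * levelMass f lam i ≤
        ∑ i ∈ Finset.range R, t j i * levelMass f lam i := by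
    intro j hj
    obtain ⟨hj1, hjN⟩ := Finset.mem_Icc.1 hj
    have hnj : (0 : ℝ) < n j := by exact_mod_cast hn j hj1
    calc _ ≤ ∑ i ∈ Finset.Ico (P j) (Nat.log 2 (4 * n j)), t j i * levelMass f lam i := by
          refine Finset.sum_le_sum fun i hi => ?_
          have hi' : len i ≤ threshold n j := by
            rw [← not_lt, hP j hj1]
            exact not_lt.2 (Finset.mem_Ico.1 hi).1
          rw [threshold, le_div_iff₀ hnj] at hi'
          have hjN' : (j : ℝ) ≤ N := by exact_mod_cast hjN
          have hj0 : (0 : ℝ) ≤ j := Nat.cast_nonneg j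
          have hlog0 : 0 ≤ Real.log ((j : ℝ) + 1) := Real.log_nonneg (by linarith)
          have hlog : Real.log ((j : ℝ) + 1) ≤ Real.log ((N : ℝ) + 1) :=
            Real.log_le_log (by linarith) (by linarith)
          have hLj : 20 * ((j : ℝ) + 1) * Real.log ((j : ℝ) + 1) ^ 2 ≤ L := by
            rw [hL]; gcongr
          have : (n j : ℝ) * len i ≤ L := by linarith
          simp only [ht, if_pos this]
          exact le_rfl
      _ ≤ _ := by
          refine Finset.sum_le_sum_of_subset_of_nonneg ?_ fun i _ _ =>
            mul_nonneg (ht0 j i) (levelMass_nonneg f lam i)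
          intro i hi
          exact Finset.mem_range.2 ((Finset.mem_Ico.1 hi).2.trans_le
            (Finset.single_le_sum (f := fun j => Nat.log 2 (4 * n j))
              (fun _ _ => Nat.zero_le _) hj))
  have hsum : ∑ j ∈ Finset.Icc 1 N,
      ∑ i ∈ Finset.Ico (P j) (Nat.log 2 (4 * n j)), n j * len i * levelMass f lam i ≤
        2 * L * ∫ x in T, ‖f x‖ := by
    calc _ ≤ ∑ j ∈ Finset.Icc 1 N, ∑ i ∈ Finset.range R, t j i * levelMass f lam i :=
          Finset.sum_le_sum hj
      _ = ∑ i ∈ Finset.range R, (∑ j ∈ Finset.Icc 1 N, t j i) * levelMass f lam i := by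
          rw [Finset.sum_comm]
          exact Finset.sum_congr rfl fun i _ => (Finset.sum_mul _ _ _).symm
      _ ≤ ∑ i ∈ Finset.range R, 2 * L * levelMass f lam i := by
          refine Finset.sum_le_sum fun i _ =>
            mul_le_mul_of_nonneg_right ?_ (levelMass_nonneg f lam i)
          have hli := len_pos i
          refine sum_Icc_truncated_le (a := fun j => n j * len i) (fun j => by positivity)
            (fun j hj => ?_) hL0 N
          have : 2 * (n j : ℝ) ≤ n (j + 1) := by exact_mod_cast hlac j hj
          nlinarith
      _ = 2 * L * ∑ i ∈ Finset.range R, levelMass f lam i := (Finset.mul_sum _ _ _).symm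
      _ ≤ _ := by
          gcongr
          exact sum_levelMass_le hf R
  calc ∑ j ∈ Finset.Icc 1 N, l2NormSq (term f lam β n j)
      ≤ ∑ j ∈ Finset.Icc 1 N, (28000000000 * lam * (∫ x in T, ‖f x‖) + 160000 * lam *
        ∑ i ∈ Finset.Ico (P j) (Nat.log 2 (4 * n j)), n j * len i * levelMass f lam i) :=
        Finset.sum_le_sum fun j hj => l2NormSq_term_le hf hlam hβ
          (hn j (Finset.mem_Icc.1 hj).1) (hP j (Finset.mem_Icc.1 hj).1)
    _ = 28000000000 * N * lam * (∫ x in T, ‖f x‖) + 160000 * lam *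
        ∑ j ∈ Finset.Icc 1 N,
          ∑ i ∈ Finset.Ico (P j) (Nat.log 2 (4 * n j)), n j * len i * levelMass f lam i := by
        simp only [Finset.sum_add_distrib, ← Finset.mul_sum, Finset.sum_const, Nat.card_Icc,
          nsmul_eq_mul, Nat.add_sub_cancel]
        ring
    _ ≤ 28000000000 * N * lam * (∫ x in T, ‖f x‖) + 160000 * lam *
        (2 * L * ∫ x in T, ‖f x‖) := by gcongr
    _ = _ := by ring

end

/-- The logarithm is at least `log 2 > 0.69`, with `7 · 0.69⁵ > 1` and `4 · 0.69³ > 1`. -/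
theorem log_estimate {N : ℕ} (hN : 1 ≤ N) :
    1 ≤ 7 * Real.log ((N : ℝ) + 1) ^ 5 ∧
      Real.log ((N : ℝ) + 1) ^ 2 ≤ 4 * Real.log ((N : ℝ) + 1) ^ 5 := by
  have hN1 : (1 : ℝ) ≤ N := by exact_mod_cast hN
  have h : 0.69 ≤ Real.log ((N : ℝ) + 1) :=
    le_trans (by linarith [Real.log_two_gt_d9]) (Real.log_le_log two_pos (by linarith))
  set l := Real.log ((N : ℝ) + 1)
  have h3 : (0.69 : ℝ) ^ 3 ≤ l ^ 3 := by gcongr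
  have h5 : (0.69 : ℝ) ^ 5 ≤ l ^ 5 := by gcongr
  norm_num at h3 h5
  refine ⟨by linarith, ?_⟩
  have : l ^ 5 = l ^ 2 * l ^ 3 := by ring
  rw [this]
  nlinarith [sq_nonneg l]

end TrigFourier

end

/-! ### Assembly of the theorem -/

theorem mainTheorem3 (β : ℕ) (hβ_odd : Odd β) (hβ : 7 < β) :
    ∃ C : ℝ, ∀ (f : ℝ → ℂ), IntegrableOn f TrigFourier.T →
      ∀ lam : ℝ, (∫ x in TrigFourier.T, ‖f x‖) / (2 * Real.pi) < lam →
      ∀ (q : ℝ) (n : ℕ → ℕ), 5 / 2 < q → (∀ j, 1 ≤ j → 1 ≤ n j) →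
        (∀ j, 1 ≤ j → q * (n j : ℝ) ≤ (n (j + 1) : ℝ)) →
        (∀ i j, 1 ≤ i → 1 ≤ j → i ≠ j →
          ∫ y in TrigFourier.T, TrigFourier.term f lam β n i y *
            (starRingEnd ℂ) (TrigFourier.term f lam β n j y) = 0) ∧
        ∀ N : ℕ,
          TrigFourier.l2NormSq (fun y => ∑ j ∈ Finset.Icc 1 N, TrigFourier.term f lam β n j y) =
            ∑ j ∈ Finset.Icc 1 N, TrigFourier.l2NormSq (TrigFourier.term f lam β n j) ∧
          ∑ j ∈ Finset.Icc 1 N, TrigFourier.l2NormSq (TrigFourier.term f lam β n j) ≤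
            C * N * Real.log ((N : ℝ) + 1) ^ 5 * (∫ x in TrigFourier.T, ‖f x‖) * lam := by
  have hβ9 : 9 ≤ β := by
    obtain ⟨k, rfl⟩ := hβ_odd
    omega
  -- Rounds up `7 · 28000000000 + 8 · 6400000 = 196051200000`, the sum of the two contributions
  -- after `log_estimate` and `N + 1 ≤ 2N`.
  refine ⟨200000000000, fun f hf lam hlam q n hq hn hlac => ?_⟩
  have hstep : ∀ j, 1 ≤ j → 5 * n j ≤ 2 * n (j + 1) := fun j hj => by
    have h1 := hlac j hj
    have h2 : (0 : ℝ) ≤ n j := Nat.cast_nonneg _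
    have h3 : 5 * (n j : ℝ) ≤ 2 * n (j + 1) := by nlinarith
    exact_mod_cast h3
  have hlt : ∀ i j, 1 ≤ i → i < j → 5 * n i ≤ 2 * n j := fun i j hi hij => by
    induction j, hij using Nat.le_induction with
    | base => exact hstep i hi
    | succ j hij ih => have := hstep j (hi.trans (by omega)); omega
  have horth : ∀ i j, 1 ≤ i → 1 ≤ j → i ≠ j →
      ∫ y in TrigFourier.T, TrigFourier.term f lam β n i y *
        (starRingEnd ℂ) (TrigFourier.term f lam β n j y) = 0 := by
    intro i j hi hj hij
    rcases lt_or_gt_of_ne hij with h | h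
    · exact (TrigFourier.term_orthogonal (hn i hi) (hlt i j hi h) f lam β).1
    · exact (TrigFourier.term_orthogonal (hn j hj) (hlt j i hj h) f lam β).2
  refine ⟨horth, fun N => ⟨?_, ?_⟩⟩
  · refine TrigFourier.integral_normSq_sum_of_orthogonal _ _ (fun i hi => ?_)
      fun i hi j hj => horth i j (Finset.mem_Icc.1 hi).1 (Finset.mem_Icc.1 hj).1
    exact TrigFourier.continuous_of_mem_trigSpan
      (TrigFourier.term_mem (hn i (Finset.mem_Icc.1 hi).1) f lam β)
  · rcases Nat.eq_zero_or_pos N with rfl | hN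
    · simp
    have hmain := TrigFourier.sum_l2NormSq_term_le hf hlam hβ9 hn
      (fun j hj => by have := hstep j hj; omega) N
    refine hmain.trans ?_
    obtain ⟨h1, h2⟩ := TrigFourier.log_estimate hN
    have hN1 : (1 : ℝ) ≤ N := by exact_mod_cast hN
    have hI : 0 ≤ ∫ x in TrigFourier.T, ‖f x‖ := integral_nonneg fun _ => norm_nonneg _
    have hA : 0 ≤ lam * ∫ x in TrigFourier.T, ‖f x‖ :=
      mul_nonneg (TrigFourier.lam_nonneg hlam) hI
    set A := lam * ∫ x in TrigFourier.T, ‖f x‖ with hAdef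
    set l := Real.log ((N : ℝ) + 1)
    have e1 : (N : ℝ) * A * 1 ≤ N * A * (7 * l ^ 5) := by gcongr
    have e2 : ((N : ℝ) + 1) * A * l ^ 2 ≤ (2 * N) * A * (4 * l ^ 5) := by
      gcongr
      linarith
    calc _ = 28000000000 * (N * A * 1) + 6400000 * (((N : ℝ) + 1) * A * l ^ 2) := by
          rw [hAdef]; ring
      _ ≤ 28000000000 * (N * A * (7 * l ^ 5)) + 6400000 * ((2 * N) * A * (4 * l ^ 5)) := by
          gcongr
      _ = 196051200000 * (N * A * l ^ 5) := by ring
      _ ≤ 200000000000 * (N * A * l ^ 5) := by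
          have : 0 ≤ N * A * l ^ 5 := by
            have : 0 ≤ l := Real.log_nonneg (by linarith)
            positivity
          linarith
      _ = _ := by rw [hAdef]; ring
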